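/- Let $\Theta=(\theta_m)_{m\ge 1}$ be a sequence of nonnegative real numbers. For $\sigma\in S_n$ let $C_m(\sigma)$ be the number of cycles of length $m$ of $\sigma$ (fixed points are cycles of length $1$), let $K_{0n}(\sigma)=\sum_{m=1}^n C_m(\sigma)$ be the total number of cycles, and put $$h_n=\frac1{n!}\sum_{\sigma\in S_n}\prod_{m=1}^n\theta_m^{C_m(\sigma)} .$$ When $h_n>0$, consider $K_{0n}$ as a random variable under the probability measure $\mathbb P_\Theta[\sigma]=\frac1{h_n\,n!}\prod_{m=1}^n\theta_m^{C_m(\sigma)}$ on $S_n$. Let $g_\Theta(t)=\sum_{k\ge1}\frac{\theta_k}{k}t^k$, assumed to converge near $0$, and write $g_\Theta$ also for its analytic continuation. For $r>0$ and $\theta\ge 0$, a function $g$ is of class $\mathcal F(r,\theta)$ with constant $K$ if there are $R>r$ and $0<\phi<\pi/2$ such that $g$ is holomorphic in $\Delta_0=\{z\in\mathbb C: |z|<R,\ z\ne r,\ |\arg(z-r)|>\phi\}$ and $$g(t)=\theta\log\frac1{1-t/r}+K+O(t-r)\qquad (t\to r,\ t\in\Delta_0).$$ For $r>0$, $\theta\ge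 0$ and $0<\gamma\le1$, a function $g$ holomorphic in $\{|t|<r\}$ is of class $e\mathcal F(r,\theta,\gamma)$ with constant $K$ if there is an analytic function $g_0(t)=\sum_{n\ge0}b_nt^n$ in the disc $\{|t|<r\}$ such that $g(t)=\theta\log\frac1{1-t/r}+g_0(t)$ for $t$ near $r$ in this disc, $b_n=O(r^{-n}n^{-1-\gamma})$, and $K=g_0(r):=\sum_{n\ge0}b_nr^n$. For $g=g_\Theta$ the constant $K$ is necessarily real, since the $\theta_k$ are. For probability measures $\mu,\nu$ on $\mathbb Z$ (or integer valued random variables with these laws) let $d_{loc}(\mu,\nu)=\sup_{j\in\mathbb Z}|\mu\{j\}-\nu\{j\}|$ and $d_K(\mu,\nu)=\sup_{j\in\mathbb Z}|\mu((-\infty,j])-\nu((-\infty,j])|$. Let $P_\lambda$ denote a Poisson random variable with parameter $\lambda\ge 0$ ($P_0=0$). Let $\theta>0$, and let $g_\Theta$ be of class $\mathcal F(r,\theta)$ or of class $e\mathcal F(r,\theta,\gamma)$, with constant $K$. Then $h_n>0$ and $K+\theta\log n>0$ for all sufficiently large $n$. Moreover: 1. If $g_\Theta$ is of class $\mathcal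 F(r,\theta)$, there are constants $c_1,c_2>0$ independent of $n$ such that, for every $n\ge2$ with $h_n>0$ and $K+\theta\log n\ge0$, $$d_{loc}(K_{0n},P_{K+\theta\log n})\le\frac{c_1}{\log n},\qquad d_K(K_{0n},P_{K+\theta\log n})\le\frac{c_2}{\sqrt{\log n}} .$$ 2. If $g_\Theta$ is of class $e\mathcal F(r,\theta,\gamma)$, there is a constant $c_3>0$ independent of $n$ such that, for every $n\ge2$ with $h_n>0$ and $K+\theta\log n\ge0$, $$d_{loc}(K_{0n},P_{K+\theta\log n})\le\frac{c_3}{\log n} .$$ -/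

import Mathlib

open Filter Topology Asymptotics MeasureTheory ProbabilityTheory
open scoped Nat

noncomputable section

/-- Every subset of the finite symmetric group is measurable. -/
instance permMeasurableSpace (n : ℕ) : MeasurableSpace (Equiv.Perm (Fin n)) := ⊤

/-- `C_m(σ)`: the number of cycles of length `m` of `σ ∈ S_n`. The cycle type is taken as a
partition of `n`, so that fixed points count as cycles of length `1`. -/
def cycleCount {n : ℕ} (m : ℕ) (σ : Equiv.Perm (Fin n)) : ℕ :=
  σ.partition.parts.count m

/-- `K_{0n}(σ)`: the total number of cycles of `σ ∈ S_n`. -/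
def totalCycles {n : ℕ} (σ : Equiv.Perm (Fin n)) : ℕ :=
  ∑ m ∈ Finset.Icc 1 n, cycleCount m σ

/-- The unnormalized weight `∏_{m=1}^n θ_m ^ C_m(σ)`. Only the values `Θ m` with `m ≥ 1` matter. -/
def cycleWeight (Θ : ℕ → ℝ) {n : ℕ} (σ : Equiv.Perm (Fin n)) : ℝ :=
  ∏ m ∈ Finset.Icc 1 n, Θ m ^ cycleCount m σ

/-- The normalization constant `h_n = (1/n!) ∑_σ ∏_m θ_m ^ C_m(σ)`. -/
def hNorm (Θ : ℕ → ℝ) (n : ℕ) : ℝ :=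
  (1 / (n ! : ℝ)) * ∑ σ : Equiv.Perm (Fin n), cycleWeight Θ σ

/-- The weighted measure on `S_n` giving `σ` the mass `(1/(h_n n!)) ∏_m θ_m ^ C_m(σ)`
(a probability measure as soon as `θ_m ≥ 0` for `m ≥ 1` and `h_n > 0`). -/
def weightedMeasure (Θ : ℕ → ℝ) (n : ℕ) : Measure (Equiv.Perm (Fin n)) :=
  ∑ σ : Equiv.Perm (Fin n),
    ENNReal.ofReal (1 / (hNorm Θ n * (n ! : ℝ)) * cycleWeight Θ σ) • Measure.dirac σ

/-- The law on `ℤ` of `K_{0n}` under the weighted measure. -/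
def lawTotalCycles (Θ : ℕ → ℝ) (n : ℕ) : Measure ℤ :=
  (weightedMeasure Θ n).map (fun σ => (totalCycles σ : ℤ))

/-- The Poisson law with parameter `lam ≥ 0`, as a measure on `ℤ`. -/
def poissonLaw (lam : ℝ) : Measure ℤ :=
  (poissonMeasure lam.toNNReal).map (fun k : ℕ => (k : ℤ))

/-- The point metric between two laws on `ℤ`. -/
def dLoc (μ ν : Measure ℤ) : ℝ :=
  ⨆ j : ℤ, |μ.real {j} - ν.real {j}|

/-- The Kolmogorov distance between two laws on `ℤ`. -/
def dKol (μ ν : Measure ℤ) : ℝ :=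
  ⨆ j : ℤ, |μ.real (Set.Iic j) - ν.real (Set.Iic j)|

/-- The formal power series `g_Θ(t) = ∑_{k ≥ 1} (θ_k / k) t^k`
(the coefficient at `k = 0` is `Θ 0 / 0 = 0`). -/
def gSeries (Θ : ℕ → ℝ) : FormalMultilinearSeries ℂ ℂ ℂ :=
  FormalMultilinearSeries.ofScalars ℂ (fun k : ℕ => ((Θ k / (k : ℝ) : ℝ) : ℂ))

/-- The domain `Δ₀(r, R, phi)`. -/
def deltaZero (r R phi : ℝ) : Set ℂ :=
  {z : ℂ | ‖z‖ < R ∧ z ≠ (r : ℂ) ∧ phi < |Complex.arg (z - (r : ℂ))|}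

/-- `g` is of class `F(r, θ)`, with `K` the constant term of its expansion at `r`. -/
def IsClassF (g : ℂ → ℂ) (r θ : ℝ) (K : ℂ) : Prop :=
  0 < r ∧ 0 ≤ θ ∧ ∃ R phi : ℝ, r < R ∧ 0 < phi ∧ phi < Real.pi / 2 ∧
    DifferentiableOn ℂ g (deltaZero r R phi) ∧
    (fun t : ℂ => g t - ((θ : ℂ) * Complex.log (1 / (1 - t / (r : ℂ))) + K))
      =O[𝓝[deltaZero r R phi] (r : ℂ)] (fun t : ℂ => t - (r : ℂ))

/-- `g` is of class `eF(r, θ, γ)`, with `K = g₀(r) = ∑ₙ bₙ rⁿ`, where `bₙ` are the Taylor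
coefficients of the function `g₀`. -/
def IsClassEF (g : ℂ → ℂ) (r θ γ : ℝ) (K : ℂ) : Prop :=
  0 < r ∧ 0 ≤ θ ∧ 0 < γ ∧ γ ≤ 1 ∧
    DifferentiableOn ℂ g (Metric.ball 0 r) ∧
    ∃ (g₀ : ℂ → ℂ) (b : ℕ → ℂ),
      HasFPowerSeriesOnBall g₀ (FormalMultilinearSeries.ofScalars ℂ b) 0 (ENNReal.ofReal r) ∧
      (∀ᶠ t : ℂ in 𝓝[Metric.ball 0 r] (r : ℂ),
        g t = (θ : ℂ) * Complex.log (1 / (1 - t / (r : ℂ))) + g₀ t) ∧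
      b =O[atTop] (fun n : ℕ => (n : ℝ) ^ (-1 - γ) / r ^ n) ∧
      HasSum (fun n : ℕ => b n * (r : ℂ) ^ n) K

end

/-! Rescaled by `r`, the coefficients of `g` are `θ/k + β k`, where `β = O(k^(-s))` for some `s > 1`
and `∑ β = K`. This is `IsLogPerturbation`, and everything probabilistic is deduced from it alone.
The exponential formula (`isExpSeries_sum_perm`) identifies `r^n (1/n!) ∑_σ w^(K_{0n}) ∏ θ_m^(C_m)`
with the coefficient of `t^n` in `(1 - t)^(-wθ) * exp(w β(t))`, where `β(t) = ∑ β k t^k`. The second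
factor has coefficients `O(k^(-s))` with sum `e^(wK)`. Convolution with such a sequence multiplies
the slowly varying coefficients of `(1 - t)^(-wθ)` by its sum, up to a power of `n` relative to the
coefficient at `w = 1` and uniformly in `|w| ≤ 1` (`exists_norm_coeff_expSeries_sub_le`). The
coefficients of `(1 - t)^(-wθ)` and `(1 - t)^(-θ)` have quotient `∏_{j<n} (1 + (w - 1)θ/(θ + j))`,
which is `exp((w - 1) θ log n) (1 + O(w - 1))` (`exists_risingCoeff_eq_mul_exp`). Dividing by the
case `w = 1` and putting `w = e^(it)`, the characteristic functions of `K_{0n}` and of the Poisson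
variable with parameter `λ = K + θ log n` differ by `O(|t| e^(-cλt²)) + O(n^(-δ))`. Fourier
inversion finishes. The integral of `|t| e^(-cλt²)` is `O(1/λ)`, which gives the point metric. For
distribution functions the kernel `∑_{j<m} e^(-ijt)` is `O(1/|t|)` and cancels the factor `|t|`,
leaving a Gaussian integral `O(λ^(-1/2))`. It remains to place both classes under
`IsLogPerturbation`. For `eF` this is the identity theorem together with uniqueness of Taylor
coefficients. For `F`, Cauchy's estimate on discs proportional to the distance from `r` bounds the
second derivative of the remainder by `O(1/|z - r|)`. Integrating over a circle of radius `r(1 -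
1/n)` gives coefficients `O(r^(-n) n^(-3/2))`, and Abel's theorem identifies their sum. -/

noncomputable section

/-! ### Exponentials of power series -/

open PowerSeries in
/-- `P` is the exponential of the power series `x`, up to the constant term of `x`. -/
structure IsExpSeries (x P : PowerSeries ℂ) : Prop where
  constantCoeff_eq : constantCoeff P = 1
  derivative_eq : derivative ℂ P = derivative ℂ x * P

namespace IsExpSeries

open PowerSeries

variable {x y P Q : PowerSeries ℂ}

theorem coeff_zero (h : IsExpSeries x P) : coeff 0 P = 1 := by
  rw [coeff_zero_eq_constantCoeff_apply, h.constantCoeff_eq]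

theorem coeff_succ (h : IsExpSeries x P) (n : ℕ) :
    coeff (n + 1) P * (n + 1) =
      ∑ p ∈ Finset.HasAntidiagonal.antidiagonal n, (coeff (p.1 + 1) x * (p.1 + 1)) * coeff p.2 P := by
  rw [← coeff_derivative, h.derivative_eq, coeff_mul]
  simp [coeff_derivative]

theorem of_coeff (h0 : coeff 0 P = 1)
    (h : ∀ n : ℕ, coeff (n + 1) P * (n + 1) =
      ∑ p ∈ Finset.HasAntidiagonal.antidiagonal n, (coeff (p.1 + 1) x * (p.1 + 1)) * coeff p.2 P) :
    IsExpSeries x P := by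
  refine ⟨by rw [← coeff_zero_eq_constantCoeff_apply, h0], ?_⟩
  ext n
  rw [coeff_derivative, h, coeff_mul]
  simp [coeff_derivative]

/-- The equation `P' = x' P` is a recursion expressing the coefficient of index `n + 1` by those of
index at most `n`. Every identification of generating functions below goes through this. -/
theorem unique (hP : IsExpSeries x P) (hQ : IsExpSeries x Q) : P = Q := by
  ext n
  induction n using Nat.strong_induction_on with
  | _ n ih =>
    rcases n with _ | n
    · rw [hP.coeff_zero, hQ.coeff_zero]
    · have hn : (n + 1 : ℂ) ≠ 0 := by exact_mod_cast n.succ_ne_zero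
      refine mul_right_cancel₀ hn ?_
      rw [hP.coeff_succ, hQ.coeff_succ]
      refine Finset.sum_congr rfl fun p hp => ?_
      rw [ih p.2 (by have := Finset.HasAntidiagonal.mem_antidiagonal.1 hp; omega)]

theorem mul (hP : IsExpSeries x P) (hQ : IsExpSeries y Q) : IsExpSeries (x + y) (P * Q) := by
  refine ⟨by simp [hP.constantCoeff_eq, hQ.constantCoeff_eq], ?_⟩
  rw [Derivation.leibniz, hP.derivative_eq, hQ.derivative_eq, map_add, smul_eq_mul, smul_eq_mul]
  ring

theorem exp_subst (hx : constantCoeff x = 0) : IsExpSeries x ((exp ℂ).subst x) := by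
  have hs : HasSubst x := HasSubst.of_constantCoeff_zero' hx
  refine ⟨?_, ?_⟩
  · rw [← coeff_zero_eq_constantCoeff_apply, coeff_subst' hs, finsum_eq_single _ 0]
    · simp
    · intro n hn
      simp [hx, hn]
  · rw [derivative_subst hs, derivative_exp, mul_comm]

end IsExpSeries

/-! ### Convolution of polynomially decaying sequences -/

theorem summable_add_one_rpow_neg {s : ℝ} (hs : 1 < s) :
    Summable fun n : ℕ => ((n : ℝ) + 1) ^ (-s) := by
  have := (summable_nat_add_iff 1).2 (Real.summable_nat_rpow.2 (by linarith : -s < -1))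
  simpa using this

/-- A constant `D` with `a * a ≤ D a` for the sequence `a n = (n + 1) ^ (-s)`. -/
def convConst (s : ℝ) : ℝ := 2 ^ s * 2 * ∑' n : ℕ, ((n : ℝ) + 1) ^ (-s)

theorem convConst_nonneg (s : ℝ) : 0 ≤ convConst s := by
  unfold convConst
  have : 0 ≤ ∑' n : ℕ, ((n : ℝ) + 1) ^ (-s) := tsum_nonneg fun n => by positivity
  positivity

/-- The larger of `i` and `j` is at least `n / 2`, so its factor is already of the size of the one
for `n`, and the other factor remains to be summed. -/
theorem rpow_mul_rpow_le_of_add_eq {s : ℝ} (hs : 0 ≤ s) {i j n : ℕ} (h : i + j = n) :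
    ((i : ℝ) + 1) ^ (-s) * ((j : ℝ) + 1) ^ (-s) ≤
      2 ^ s * ((n : ℝ) + 1) ^ (-s) * (((i : ℝ) + 1) ^ (-s) + ((j : ℝ) + 1) ^ (-s)) := by
  have key : ∀ k l : ℕ, k + l = n → k ≤ l →
      ((l : ℝ) + 1) ^ (-s) ≤ 2 ^ s * ((n : ℝ) + 1) ^ (-s) := by
    intro k l hkl hle
    have h1 : ((n : ℝ) + 1) / 2 ≤ (l : ℝ) + 1 := by
      have : (n : ℝ) = k + l := by exact_mod_cast hkl.symm
      have : (k : ℝ) ≤ l := by exact_mod_cast hle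
      linarith
    calc ((l : ℝ) + 1) ^ (-s) ≤ (((n : ℝ) + 1) / 2) ^ (-s) :=
          Real.rpow_le_rpow_of_nonpos (by positivity) h1 (by linarith)
      _ = 2 ^ s * ((n : ℝ) + 1) ^ (-s) := by
          rw [Real.div_rpow (by positivity) (by positivity), Real.rpow_neg (by norm_num : (0:ℝ) ≤ 2)]
          field_simp
  have pi : 0 ≤ ((i : ℝ) + 1) ^ (-s) := by positivity
  have pj : 0 ≤ ((j : ℝ) + 1) ^ (-s) := by positivity
  have pn : 0 ≤ 2 ^ s * ((n : ℝ) + 1) ^ (-s) := by positivity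
  rcases le_total i j with hij | hij
  · nlinarith [key i j h hij, mul_nonneg pn pj]
  · nlinarith [key j i (by omega) hij, mul_nonneg pn pi]

theorem sum_antidiagonal_rpow_le {s : ℝ} (hs : 1 < s) (n : ℕ) :
    ∑ p ∈ Finset.HasAntidiagonal.antidiagonal n, ((p.1 : ℝ) + 1) ^ (-s) * ((p.2 : ℝ) + 1) ^ (-s) ≤
      convConst s * ((n : ℝ) + 1) ^ (-s) := by
  have hS : ∑ i ∈ Finset.range (n + 1), ((i : ℝ) + 1) ^ (-s) ≤ ∑' n : ℕ, ((n : ℝ) + 1) ^ (-s) :=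
    (summable_add_one_rpow_neg hs).sum_le_tsum _ fun i _ => by positivity
  have h1 : ∑ p ∈ Finset.HasAntidiagonal.antidiagonal n, ((p.1 : ℝ) + 1) ^ (-s) =
      ∑ i ∈ Finset.range (n + 1), ((i : ℝ) + 1) ^ (-s) :=
    Finset.Nat.sum_antidiagonal_eq_sum_range_succ (fun i _ => ((i : ℝ) + 1) ^ (-s)) n
  have h2 : ∑ p ∈ Finset.HasAntidiagonal.antidiagonal n, ((p.2 : ℝ) + 1) ^ (-s) =
      ∑ i ∈ Finset.range (n + 1), ((i : ℝ) + 1) ^ (-s) := by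
    rw [← h1]
    exact Finset.Nat.sum_antidiagonal_swap (n := n) (f := fun p => ((p.1 : ℝ) + 1) ^ (-s))
  calc _ ≤ ∑ p ∈ Finset.HasAntidiagonal.antidiagonal n,
        2 ^ s * ((n : ℝ) + 1) ^ (-s) * (((p.1 : ℝ) + 1) ^ (-s) + ((p.2 : ℝ) + 1) ^ (-s)) :=
        Finset.sum_le_sum fun p hp =>
          rpow_mul_rpow_le_of_add_eq (by linarith) (Finset.HasAntidiagonal.mem_antidiagonal.1 hp)
    _ = 2 ^ s * ((n : ℝ) + 1) ^ (-s) * (2 * ∑ i ∈ Finset.range (n + 1), ((i : ℝ) + 1) ^ (-s)) := by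
        rw [← Finset.mul_sum, Finset.sum_add_distrib, h1, h2]; ring
    _ ≤ 2 ^ s * ((n : ℝ) + 1) ^ (-s) * (2 * ∑' n : ℕ, ((n : ℝ) + 1) ^ (-s)) := by gcongr
    _ = _ := by unfold convConst; ring

-- Up to the constant `convConst s`, sequences of size `(n + 1)^(-s)` form a convolution algebra, so
-- powers cost only a geometric factor, which the factorials of the exponential absorb.
open PowerSeries in
theorem norm_coeff_pow_le {s : ℝ} (hs : 1 < s) {x : PowerSeries ℂ} {B : ℝ} (hB : 0 ≤ B)
    (hx : ∀ n : ℕ, ‖coeff n x‖ ≤ B * ((n : ℝ) + 1) ^ (-s)) (j n : ℕ) :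
    ‖coeff n (x ^ j)‖ ≤ (B * convConst s) ^ j * ((n : ℝ) + 1) ^ (-s) := by
  have hD := convConst_nonneg s
  induction j generalizing n with
  | zero =>
    rw [pow_zero, pow_zero, coeff_one]
    split_ifs with h
    · simp [h]
    · simp; positivity
  | succ j ih =>
    rw [pow_succ, coeff_mul]
    calc _ ≤ ∑ p ∈ Finset.HasAntidiagonal.antidiagonal n, ‖coeff p.1 (x ^ j) * coeff p.2 x‖ := norm_sum_le _ _
      _ ≤ ∑ p ∈ Finset.HasAntidiagonal.antidiagonal n, (B * convConst s) ^ j * B *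
            (((p.1 : ℝ) + 1) ^ (-s) * ((p.2 : ℝ) + 1) ^ (-s)) := by
          refine Finset.sum_le_sum fun p _ => ?_
          rw [norm_mul]
          calc _ ≤ ((B * convConst s) ^ j * ((p.1 : ℝ) + 1) ^ (-s)) *
                (B * ((p.2 : ℝ) + 1) ^ (-s)) := by
                gcongr
                · exact ih _
                · exact hx _
            _ = _ := by ring
      _ ≤ (B * convConst s) ^ j * B * (convConst s * ((n : ℝ) + 1) ^ (-s)) := by
          rw [← Finset.mul_sum]
          gcongr
          exact sum_antidiagonal_rpow_le hs n
      _ = _ := by ring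

open PowerSeries in
theorem hasSum_coeff_pow {s : ℝ} (hs : 1 < s) {x : PowerSeries ℂ} {B : ℝ} (hB : 0 ≤ B)
    (hx : ∀ n : ℕ, ‖coeff n x‖ ≤ B * ((n : ℝ) + 1) ^ (-s)) {K : ℂ}
    (hK : HasSum (fun n => coeff n x) K) (j : ℕ) :
    HasSum (fun n => coeff n (x ^ j)) (K ^ j) := by
  have hsum : ∀ j : ℕ, Summable fun n => ‖coeff n (x ^ j)‖ := fun j =>
    Summable.of_nonneg_of_le (fun _ => norm_nonneg _) (norm_coeff_pow_le hs hB hx j)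
      ((summable_add_one_rpow_neg hs).mul_left _)
  induction j with
  | zero =>
    simp only [pow_zero, coeff_one]
    exact hasSum_ite_eq 0 1
  | succ j ih =>
    have h1 : Summable fun n => ‖coeff n x‖ := by simpa using hsum 1
    have := tsum_mul_tsum_eq_tsum_sum_antidiagonal_of_summable_norm (hsum j) h1
    rw [ih.tsum_eq, hK.tsum_eq] at this
    simp_rw [← coeff_mul, ← pow_succ] at this
    rw [this]
    exact (hsum (j + 1)).of_norm.hasSum

-- The double family `coeff n (x^j) / j!` is absolutely summable. Summing over `j` first gives the
-- coefficients of `P`, and over `n` first gives the exponential series of `K`.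
open PowerSeries in
theorem IsExpSeries.norm_coeff_le_and_hasSum {s : ℝ} (hs : 1 < s) {x P : PowerSeries ℂ}
    (hP : IsExpSeries x P) (hx0 : constantCoeff x = 0) {B : ℝ} (hB : 0 ≤ B)
    (hx : ∀ n : ℕ, ‖coeff n x‖ ≤ B * ((n : ℝ) + 1) ^ (-s)) {K : ℂ}
    (hK : HasSum (fun n => coeff n x) K) :
    (∀ n : ℕ, ‖coeff n P‖ ≤ Real.exp (B * convConst s) * ((n : ℝ) + 1) ^ (-s)) ∧
      HasSum (fun n => coeff n P) (Complex.exp K) := by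
  have hs0 : HasSubst x := HasSubst.of_constantCoeff_zero' hx0
  obtain rfl := hP.unique (IsExpSeries.exp_subst hx0)
  set f : ℕ × ℕ → ℂ := fun q => ((q.1 ! : ℂ))⁻¹ * coeff q.2 (x ^ q.1) with hf
  have hbound : ∀ q : ℕ × ℕ, ‖f q‖ ≤
      ((B * convConst s) ^ q.1 / (q.1 ! : ℝ)) * ((q.2 : ℝ) + 1) ^ (-s) := by
    rintro ⟨j, n⟩
    simp only [hf, norm_mul, norm_inv, Complex.norm_natCast]
    have := norm_coeff_pow_le hs hB hx j n
    calc _ ≤ ((j ! : ℝ))⁻¹ * ((B * convConst s) ^ j * ((n : ℝ) + 1) ^ (-s)) := by gcongr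
      _ = _ := by ring
  have hexp := NormedSpace.expSeries_div_hasSum_exp (B * convConst s)
  rw [← Real.exp_eq_exp_ℝ] at hexp
  have hsumm : Summable f := by
    refine Summable.of_norm_bounded ?_ hbound
    exact hexp.summable.mul_of_nonneg (summable_add_one_rpow_neg hs)
      (fun j => by have := convConst_nonneg s; positivity) (fun n => by positivity)
  have hcoeff : ∀ n, HasSum (fun j => f (j, n)) (coeff n ((PowerSeries.exp ℂ).subst x)) := by
    intro n
    have hsupp := coeff_subst_finite' hs0 (PowerSeries.exp ℂ) n
    rw [coeff_subst' hs0, finsum_eq_sum _ hsupp]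
    have : (fun j => f (j, n)) = fun j => coeff j (PowerSeries.exp ℂ) • coeff n (x ^ j) := by
      ext j
      simp [hf]
    rw [this]
    exact hasSum_sum_of_ne_finset_zero fun j hj => by
      by_contra hne
      exact hj (by simpa using hne)
  refine ⟨fun n => ?_, ?_⟩
  · have h1 : HasSum (fun j => ((B * convConst s) ^ j / (j ! : ℝ)) * ((n : ℝ) + 1) ^ (-s))
        (Real.exp (B * convConst s) * ((n : ℝ) + 1) ^ (-s)) := hexp.mul_right _
    rw [← (hcoeff n).tsum_eq]
    exact tsum_of_norm_bounded h1 fun j => hbound (j, n)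
  · have hrow : ∀ j, HasSum (fun n => f (j, n)) ((j ! : ℂ)⁻¹ * K ^ j) := by
      intro j
      have := (hasSum_coeff_pow hs hB hx hK j).mul_left (j ! : ℂ)⁻¹
      simpa only [hf] using this
    have hK1 : HasSum (fun j : ℕ => (j ! : ℂ)⁻¹ * K ^ j) (Complex.exp K) := by
      have := NormedSpace.expSeries_div_hasSum_exp K
      rw [Complex.exp_eq_exp_ℂ]
      simpa only [div_eq_inv_mul] using this
    have hall : HasSum f (Complex.exp K) := by
      have h1 := hsumm.hasSum.prod_fiberwise hrow
      rw [← h1.unique hK1]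
      exact hsumm.hasSum
    have hswap : HasSum (f ∘ Prod.swap) (Complex.exp K) :=
      (Equiv.prodComm ℕ ℕ).hasSum_iff.2 hall
    exact hswap.prod_fiberwise fun n => hcoeff n

/-! ### The coefficients of `(1 - t) ^ (-a)` -/

/-- The coefficient of `t ^ n` in `(1 - t) ^ (-a)`. -/
def risingCoeff {𝕜 : Type*} [Field 𝕜] (a : 𝕜) (n : ℕ) : 𝕜 :=
  ∏ j ∈ Finset.range n, (a + j) / (j + 1)

section risingCoeff

variable {𝕜 : Type*} [Field 𝕜]

@[simp]
theorem risingCoeff_zero (a : 𝕜) : risingCoeff a 0 = 1 := by simp [risingCoeff]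

theorem risingCoeff_succ (a : 𝕜) (n : ℕ) :
    risingCoeff a (n + 1) = risingCoeff a n * ((a + n) / (n + 1)) := by
  rw [risingCoeff, Finset.prod_range_succ, risingCoeff]

theorem risingCoeff_succ_mul [CharZero 𝕜] (a : 𝕜) (n : ℕ) :
    risingCoeff a (n + 1) * (n + 1) = risingCoeff a n * (a + n) := by
  have : (n + 1 : 𝕜) ≠ 0 := by exact_mod_cast n.succ_ne_zero
  rw [risingCoeff_succ]
  field_simp

/-- Partial sums are the coefficients of `(1 - t)^(-a-1)`, so they have a closed form; it yields
both the differential equation below and the size of the partial sums. -/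
theorem mul_sum_risingCoeff [CharZero 𝕜] (a : 𝕜) (n : ℕ) :
    a * ∑ m ∈ Finset.range (n + 1), risingCoeff a m = risingCoeff a n * (a + n) := by
  induction n with
  | zero => simp
  | succ n ih =>
    rw [Finset.sum_range_succ, mul_add, ih, ← risingCoeff_succ_mul]
    push_cast
    ring

open PowerSeries in
theorem isExpSeries_risingCoeff (a : ℂ) :
    IsExpSeries (PowerSeries.mk fun k : ℕ => a / k) (PowerSeries.mk (risingCoeff a)) := by
  refine IsExpSeries.of_coeff (by simp) fun n => ?_
  simp only [coeff_mk]
  have h1 : ∑ p ∈ Finset.HasAntidiagonal.antidiagonal n,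
      (a / ((p.1 + 1 : ℕ) : ℂ) * (p.1 + 1)) * risingCoeff a p.2 =
      ∑ p ∈ Finset.HasAntidiagonal.antidiagonal n, a * risingCoeff a p.2 := by
    refine Finset.sum_congr rfl fun p _ => ?_
    have : (p.1 : ℂ) + 1 ≠ 0 := by exact_mod_cast p.1.succ_ne_zero
    push_cast
    field_simp
  rw [h1, ← Finset.Nat.sum_antidiagonal_swap, risingCoeff_succ_mul, ← mul_sum_risingCoeff,
    Finset.mul_sum]
  exact (Finset.Nat.sum_antidiagonal_eq_sum_range_succ (fun i _ => a * risingCoeff a i) n).symm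

theorem norm_risingCoeff_le {a : ℂ} {θ : ℝ} (h : ‖a‖ ≤ θ) (n : ℕ) :
    ‖risingCoeff a n‖ ≤ risingCoeff θ n := by
  rw [risingCoeff, norm_prod]
  refine Finset.prod_le_prod (fun _ _ => norm_nonneg _) fun j _ => ?_
  rw [norm_div]
  have h1 : ‖(j : ℂ) + 1‖ = j + 1 := by exact_mod_cast Complex.norm_natCast (j + 1)
  rw [h1]
  have h2 : ‖a + j‖ ≤ θ + j := (norm_add_le _ _).trans (by simpa using h)
  gcongr

end risingCoeff

theorem risingCoeff_pos {θ : ℝ} (hθ : 0 < θ) (n : ℕ) : 0 < risingCoeff θ n :=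
  Finset.prod_pos fun j _ => by positivity

theorem nat_mul_risingCoeff_mono {θ : ℝ} (hθ : 0 < θ) {m n : ℕ} (h : m ≤ n) :
    m * risingCoeff θ m ≤ n * risingCoeff θ n := by
  refine monotone_nat_of_le_succ (f := fun n : ℕ => (n : ℝ) * risingCoeff θ n) (fun n => ?_) h
  have := risingCoeff_succ_mul θ n
  push_cast
  nlinarith [risingCoeff_pos hθ n]

theorem sum_risingCoeff_le {θ : ℝ} (hθ : 0 < θ) {n : ℕ} (hn : 1 ≤ n) :
    ∑ m ∈ Finset.range (n + 1), risingCoeff θ m ≤ (1 + 1 / θ) * n * risingCoeff θ n := by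
  have h := mul_sum_risingCoeff θ n
  have h1 : ∑ m ∈ Finset.range (n + 1), risingCoeff θ m = risingCoeff θ n * (θ + n) / θ := by
    rw [← h]; field_simp
  rw [h1, div_le_iff₀ hθ]
  have h2 : (1 + 1 / θ) * n * risingCoeff θ n * θ = risingCoeff θ n * (θ * n + n) := by
    field_simp
  rw [h2]
  have := risingCoeff_pos hθ n
  have hn' : (1 : ℝ) ≤ n := by exact_mod_cast hn
  gcongr
  nlinarith

/-- Consecutive coefficients differ by the factor `(a - 1)/(m + 1)`, and monotonicity of `m *
risingCoeff θ m` gives `risingCoeff θ m ≤ 2 * risingCoeff θ n` on `n/2 ≤ m ≤ n`. The bound adds up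
`k` such steps. -/
theorem norm_risingCoeff_sub_le {θ : ℝ} (hθ : 0 < θ) {a : ℂ} (ha : ‖a‖ ≤ θ) {k n : ℕ}
    (hn : 1 ≤ n) (hk : 2 * k ≤ n) :
    ‖risingCoeff a (n - k) - risingCoeff a n‖ ≤ 4 * (θ + 1) * (k / n) * risingCoeff θ n := by
  have hn' : (0 : ℝ) < n := by exact_mod_cast hn
  have step : ∀ m : ℕ, n ≤ 2 * m → m < n →
      ‖risingCoeff a (m + 1) - risingCoeff a m‖ ≤ 4 * (θ + 1) / n * risingCoeff θ n := by
    intro m hm hmn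
    have hm0 : (0 : ℝ) < m := by exact_mod_cast (by omega : 0 < m)
    have hm2 : (n : ℝ) ≤ 2 * m := by exact_mod_cast hm
    have h1 : (m : ℂ) + 1 ≠ 0 := by exact_mod_cast m.succ_ne_zero
    have h2 : risingCoeff a (m + 1) - risingCoeff a m = risingCoeff a m * ((a - 1) / (m + 1)) := by
      rw [risingCoeff_succ]; field_simp; ring
    have h3 : ‖(m : ℂ) + 1‖ = m + 1 := by exact_mod_cast Complex.norm_natCast (m + 1)
    rw [h2, norm_mul, norm_div, h3]
    have h4 : ‖a - 1‖ ≤ θ + 1 := (norm_sub_le _ _).trans (by simpa using ha)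
    have h5 : risingCoeff θ m ≤ 2 * risingCoeff θ n := by
      have := nat_mul_risingCoeff_mono hθ hmn.le
      have hp := risingCoeff_pos hθ n
      have : (m : ℝ) * risingCoeff θ m ≤ m * (2 * risingCoeff θ n) := by nlinarith
      exact le_of_mul_le_mul_left this hm0
    have h6 : (θ + 1) / ((m : ℝ) + 1) ≤ 2 * (θ + 1) / n := by
      rw [div_le_div_iff₀ (by positivity) hn']
      nlinarith
    calc ‖risingCoeff a m‖ * (‖a - 1‖ / (m + 1))
        ≤ (2 * risingCoeff θ n) * ((θ + 1) / (m + 1)) := by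
          have := risingCoeff_pos hθ n
          gcongr
          exact (norm_risingCoeff_le ha m).trans h5
      _ ≤ (2 * risingCoeff θ n) * (2 * (θ + 1) / n) := by
          have := risingCoeff_pos hθ n
          gcongr
      _ = _ := by ring
  induction k with
  | zero => simp
  | succ k ih =>
    have h1 := ih (by omega)
    have h2 := step (n - (k + 1)) (by omega) (by omega)
    rw [show n - (k + 1) + 1 = n - k by omega, norm_sub_rev] at h2
    calc _ = ‖(risingCoeff a (n - (k + 1)) - risingCoeff a (n - k)) +
          (risingCoeff a (n - k) - risingCoeff a n)‖ := by congr 1; ring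
      _ ≤ _ := norm_add_le _ _
      _ ≤ 4 * (θ + 1) / n * risingCoeff θ n + 4 * (θ + 1) * (k / n) * risingCoeff θ n :=
          add_le_add h2 h1
      _ = _ := by push_cast; ring

/-- Convolving the coefficients of `(1 - t) ^ (-a)` with a sequence `c = O(k ^ (-s))`, `s > 1`,
multiplies them asymptotically by the sum of `c`. -/
theorem exists_norm_conv_risingCoeff_sub_le {s θ C : ℝ} (hs : 1 < s) (hs2 : s ≤ 2)
    (hθ : 0 < θ) (hC : 0 ≤ C) :
    ∃ M : ℝ, 0 ≤ M ∧ ∀ (c : ℕ → ℂ) (S a : ℂ), ‖a‖ ≤ θ →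
      (∀ k : ℕ, ‖c k‖ ≤ C * ((k : ℝ) + 1) ^ (-s)) → HasSum c S → ∀ n : ℕ, 1 ≤ n →
      ‖∑ p ∈ Finset.HasAntidiagonal.antidiagonal n, c p.1 * risingCoeff a p.2
        - S * risingCoeff a n‖ ≤ M * (n : ℝ) ^ (-((s - 1) / 2)) * risingCoeff θ n := by
  set δ := (s - 1) / 2 with hδ
  have hδ0 : 0 < δ := by rw [hδ]; linarith
  have hδs : s = 1 + δ + δ := by rw [hδ]; ring
  set Z := ∑' k : ℕ, ((k : ℝ) + 1) ^ (-(1 + δ)) with hZ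
  have hZs : Summable fun k : ℕ => ((k : ℝ) + 1) ^ (-(1 + δ)) :=
    summable_add_one_rpow_neg (by linarith)
  have hZ0 : 0 ≤ Z := tsum_nonneg fun k => by positivity
  set M1 := C * (4 * (θ + 1) + 2 ^ δ) with hM1
  refine ⟨M1 * Z + C * 2 ^ s * (1 + 1 / θ), by positivity, ?_⟩
  intro c S a ha hc hS n hn
  have hn' : (0 : ℝ) < n := by exact_mod_cast hn
  have hn1 : (1 : ℝ) ≤ n := by exact_mod_cast hn
  have hA := risingCoeff_pos hθ n
  set u : ℕ → ℂ := fun k => if k ≤ n then c k * risingCoeff a (n - k) else 0 with hu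
  have husum : HasSum u (∑ p ∈ Finset.HasAntidiagonal.antidiagonal n,
      c p.1 * risingCoeff a p.2) := by
    rw [Finset.Nat.sum_antidiagonal_eq_sum_range_succ_mk]
    have h1 : ∑ k ∈ Finset.range (n + 1), c k * risingCoeff a (n - k) =
        ∑ k ∈ Finset.range (n + 1), u k := by
      refine Finset.sum_congr rfl fun k hk => ?_
      rw [hu]
      simp only
      rw [if_pos (by have := Finset.mem_range.1 hk; omega)]
    simp only
    rw [h1]
    refine hasSum_sum_of_ne_finset_zero fun k hk => ?_
    rw [hu]
    simp only
    rw [if_neg (by have := Finset.mem_range.not.1 hk; omega)]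
  have htsum := husum.sub (hS.mul_right (risingCoeff a n))
  -- `v` majorizes the convolution terms with `k > n/2`: there `c k` is `O(n^(-s))`, and the sum of
  -- all `risingCoeff θ (n - k)` is `O(n * risingCoeff θ n)`.
  set v : ℕ → ℝ := fun k => if k ≤ n then C * (2 ^ s * (n : ℝ) ^ (-s)) * risingCoeff θ (n - k) else 0
    with hv
  have hvsum : HasSum v (∑ k ∈ Finset.range (n + 1),
      C * (2 ^ s * (n : ℝ) ^ (-s)) * risingCoeff θ (n - k)) := by
    have h1 : ∑ k ∈ Finset.range (n + 1), C * (2 ^ s * (n : ℝ) ^ (-s)) * risingCoeff θ (n - k) =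
        ∑ k ∈ Finset.range (n + 1), v k := by
      refine Finset.sum_congr rfl fun k hk => ?_
      rw [hv]
      simp only
      rw [if_pos (by have := Finset.mem_range.1 hk; omega)]
    rw [h1]
    refine hasSum_sum_of_ne_finset_zero fun k hk => ?_
    rw [hv]
    simp only
    rw [if_neg (by have := Finset.mem_range.not.1 hk; omega)]
  have hvnn : ∀ k, 0 ≤ v k := by
    intro k
    rw [hv]
    simp only
    split_ifs
    · have := risingCoeff_pos hθ (n - k)
      positivity
    · exact le_rfl
  have hbig := (hZs.hasSum.mul_left (M1 * (n : ℝ) ^ (-δ) * risingCoeff θ n)).add hvsum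
  have split : ∀ k : ℕ, ((k : ℝ) + 1) ^ (-s) = ((k : ℝ) + 1) ^ (-(1 + δ)) * ((k : ℝ) + 1) ^ (-δ) := by
    intro k
    rw [← Real.rpow_add (by positivity)]
    congr 1
    rw [hδs]
    ring
  have hpt : ∀ k, ‖u k - c k * risingCoeff a n‖ ≤
      M1 * (n : ℝ) ^ (-δ) * risingCoeff θ n * ((k : ℝ) + 1) ^ (-(1 + δ)) + v k := by
    intro k
    have hkp : (0 : ℝ) < (k : ℝ) + 1 := by positivity
    by_cases hk : 2 * k ≤ n
    · have hkn : k ≤ n := by omega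
      have e1 : u k - c k * risingCoeff a n = c k * (risingCoeff a (n - k) - risingCoeff a n) := by
        rw [hu]; simp only; rw [if_pos hkn]; ring
      -- The excess decay `s - 1 = 2δ` is split evenly: one `δ` is traded here for the power of `n`,
      -- and the other keeps the sum over `k` convergent.
      have e2 : (k : ℝ) / n ≤ ((k : ℝ) + 1) ^ δ * (n : ℝ) ^ (-δ) := by
        have hx1 : ((k : ℝ) + 1) / n ≤ 1 := by
          rw [div_le_one hn']
          exact_mod_cast (by omega : k + 1 ≤ n)
        calc (k : ℝ) / n ≤ ((k : ℝ) + 1) / n := by gcongr; linarith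
          _ = (((k : ℝ) + 1) / n) ^ (1 : ℝ) := (Real.rpow_one _).symm
          _ ≤ (((k : ℝ) + 1) / n) ^ δ :=
            Real.rpow_le_rpow_of_exponent_ge (by positivity) hx1 (by linarith)
          _ = _ := by
            rw [Real.div_rpow hkp.le hn'.le, Real.rpow_neg hn'.le, div_eq_mul_inv]
      have e3 : ((k : ℝ) + 1) ^ (-δ) * ((k : ℝ) + 1) ^ δ = 1 := by
        rw [← Real.rpow_add hkp]; simp
      rw [e1, norm_mul]
      calc _ ≤ (C * (((k : ℝ) + 1) ^ (-(1 + δ)) * ((k : ℝ) + 1) ^ (-δ))) *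
            (4 * (θ + 1) * (((k : ℝ) + 1) ^ δ * (n : ℝ) ^ (-δ)) * risingCoeff θ n) := by
            refine mul_le_mul ((hc k).trans_eq (by rw [split])) ?_ (norm_nonneg _) (by positivity)
            refine (norm_risingCoeff_sub_le hθ ha hn hk).trans ?_
            gcongr
        _ = C * (4 * (θ + 1)) * (n : ℝ) ^ (-δ) * risingCoeff θ n * ((k : ℝ) + 1) ^ (-(1 + δ)) *
            (((k : ℝ) + 1) ^ (-δ) * ((k : ℝ) + 1) ^ δ) := by ring
        _ = C * (4 * (θ + 1)) * (n : ℝ) ^ (-δ) * risingCoeff θ n * ((k : ℝ) + 1) ^ (-(1 + δ)) := by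
            rw [e3, mul_one]
        _ ≤ M1 * (n : ℝ) ^ (-δ) * risingCoeff θ n * ((k : ℝ) + 1) ^ (-(1 + δ)) := by
            rw [hM1]
            gcongr
            exact le_add_of_nonneg_right (by positivity)
        _ ≤ _ := le_add_of_nonneg_right (hvnn k)
    · have hk2 : (n : ℝ) / 2 ≤ (k : ℝ) + 1 := by
        have : (n : ℝ) ≤ 2 * k := by exact_mod_cast (by omega : n ≤ 2 * k)
        linarith
      have hpow : ∀ e : ℝ, 0 ≤ e → ((k : ℝ) + 1) ^ (-e) ≤ 2 ^ e * (n : ℝ) ^ (-e) := by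
        intro e he
        calc ((k : ℝ) + 1) ^ (-e) ≤ ((n : ℝ) / 2) ^ (-e) :=
              Real.rpow_le_rpow_of_nonpos (by positivity) hk2 (by linarith)
          _ = _ := by
              rw [Real.div_rpow hn'.le (by norm_num), Real.rpow_neg (by norm_num : (0 : ℝ) ≤ 2)]
              field_simp
      have f1 : ‖c k * risingCoeff a n‖ ≤
          M1 * (n : ℝ) ^ (-δ) * risingCoeff θ n * ((k : ℝ) + 1) ^ (-(1 + δ)) := by
        rw [norm_mul]
        calc _ ≤ (C * (((k : ℝ) + 1) ^ (-(1 + δ)) * (2 ^ δ * (n : ℝ) ^ (-δ)))) *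
              risingCoeff θ n := by
              refine mul_le_mul ((hc k).trans ?_) (norm_risingCoeff_le ha n) (norm_nonneg _)
                (by positivity)
              rw [split]
              gcongr
              exact hpow δ hδ0.le
          _ = C * 2 ^ δ * (n : ℝ) ^ (-δ) * risingCoeff θ n * ((k : ℝ) + 1) ^ (-(1 + δ)) := by ring
          _ ≤ _ := by
              rw [hM1]
              gcongr
              exact le_add_of_nonneg_left (by positivity)
      have f2 : ‖u k‖ ≤ v k := by
        rw [hu, hv]
        simp only
        split_ifs with hkn
        · rw [norm_mul]
          gcongr
          · exact (hc k).trans (by gcongr; exact hpow s (by linarith))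
          · exact norm_risingCoeff_le ha _
        · simp
      calc _ ≤ ‖u k‖ + ‖c k * risingCoeff a n‖ := norm_sub_le _ _
        _ ≤ _ := by linarith
  rw [← htsum.tsum_eq]
  refine (tsum_of_norm_bounded hbig hpt).trans ?_
  rw [← Finset.mul_sum]
  have hrefl : ∑ k ∈ Finset.range (n + 1), risingCoeff θ (n - k) =
      ∑ m ∈ Finset.range (n + 1), risingCoeff θ m := by
    rw [← Finset.sum_range_reflect (fun m => risingCoeff θ m)]
    simp
  have hpn : (n : ℝ) ^ (-s) * n ≤ (n : ℝ) ^ (-δ) := by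
    nth_rw 2 [← Real.rpow_one (n : ℝ)]
    rw [← Real.rpow_add hn']
    exact Real.rpow_le_rpow_of_exponent_le hn1 (by linarith)
  calc _ ≤ M1 * (n : ℝ) ^ (-δ) * risingCoeff θ n * Z + C * (2 ^ s * (n : ℝ) ^ (-s)) *
        ((1 + 1 / θ) * n * risingCoeff θ n) := by
        rw [hrefl]
        gcongr
        exact sum_risingCoeff_le hθ hn
    _ = M1 * (n : ℝ) ^ (-δ) * risingCoeff θ n * Z + C * 2 ^ s * (1 + 1 / θ) *
        ((n : ℝ) ^ (-s) * n) * risingCoeff θ n := by ring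
    _ ≤ M1 * (n : ℝ) ^ (-δ) * risingCoeff θ n * Z + C * 2 ^ s * (1 + 1 / θ) *
        (n : ℝ) ^ (-δ) * risingCoeff θ n := by gcongr
    _ = _ := by ring

/-- Asymptotics of the coefficients of `exp (w x)` where `x k = θ / k + β k` and
`β = O(k ^ (-s))`, `s > 1`, uniformly in the closed unit disc. -/
theorem exists_norm_coeff_expSeries_sub_le {s θ B K : ℝ} (hs : 1 < s) (hs2 : s ≤ 2) (hθ : 0 < θ)
    {β : ℕ → ℝ} (hβ0 : β 0 = 0) (hβ : ∀ k : ℕ, |β k| ≤ B * ((k : ℝ) + 1) ^ (-s))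
    (hK : HasSum β K) :
    ∃ M : ℝ, 0 ≤ M ∧ ∀ w : ℂ, ‖w‖ ≤ 1 → ∀ P : PowerSeries ℂ,
      IsExpSeries (PowerSeries.mk fun k : ℕ => w * ((θ / k + β k : ℝ) : ℂ)) P → ∀ n : ℕ, 1 ≤ n →
      ‖PowerSeries.coeff n P - Complex.exp (w * K) * risingCoeff (w * θ) n‖ ≤
        M * (n : ℝ) ^ (-((s - 1) / 2)) * risingCoeff θ n := by
  have hB : 0 ≤ B := by simpa [hβ0] using hβ 0
  obtain ⟨M, hM, h⟩ := exists_norm_conv_risingCoeff_sub_le hs hs2 hθ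
    (Real.exp_pos (B * convConst s)).le
  refine ⟨M, hM, fun w hw P hP n hn => ?_⟩
  set y : PowerSeries ℂ := PowerSeries.mk fun k : ℕ => w * (β k : ℂ) with hy
  have hy0 : PowerSeries.constantCoeff y = 0 := by
    rw [← PowerSeries.coeff_zero_eq_constantCoeff_apply, hy, PowerSeries.coeff_mk, hβ0]
    simp
  have hyb : ∀ k : ℕ, ‖PowerSeries.coeff k y‖ ≤ B * ((k : ℝ) + 1) ^ (-s) := by
    intro k
    rw [hy, PowerSeries.coeff_mk, norm_mul, Complex.norm_real, Real.norm_eq_abs]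
    exact (mul_le_of_le_one_left (abs_nonneg _) hw).trans (hβ k)
  have hyK : HasSum (fun k => PowerSeries.coeff k y) (w * K) := by
    simp only [hy, PowerSeries.coeff_mk]
    exact (Complex.hasSum_ofReal.2 hK).mul_left w
  have hE := IsExpSeries.exp_subst hy0
  obtain ⟨h1, h2⟩ := hE.norm_coeff_le_and_hasSum hs hy0 hB hyb hyK
  have hPeq : P = (PowerSeries.exp ℂ).subst y * PowerSeries.mk (risingCoeff (w * θ)) := by
    refine hP.unique ?_
    convert hE.mul (isExpSeries_risingCoeff (w * θ)) using 1
    ext k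
    simp only [hy, PowerSeries.coeff_mk, map_add]
    push_cast
    ring
  have ha : ‖w * (θ : ℂ)‖ ≤ θ := by
    rw [norm_mul, Complex.norm_real, Real.norm_eq_abs, abs_of_pos hθ]
    exact mul_le_of_le_one_left hθ.le hw
  have := h (fun k => PowerSeries.coeff k ((PowerSeries.exp ℂ).subst y)) _ _ ha h1 h2 n hn
  rw [hPeq, PowerSeries.coeff_mul]
  simpa only [PowerSeries.coeff_mk] using this

/-! ### Comparison of `risingCoeff` with a Poisson characteristic function -/

theorem norm_one_add_mul_exp_neg_sub_one_le {z : ℂ} (hz : ‖z‖ ≤ 2) :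
    ‖(1 + z) * Complex.exp (-z) - 1‖ ≤ Real.exp 4 * ‖z‖ ^ 2 := by
  have h1 := Complex.norm_exp_sub_sum_le_norm_mul_exp z 2
  have h2 : (1 + z) * Complex.exp (-z) - 1 =
      -(Complex.exp (-z) * (Complex.exp z - (1 + z))) := by
    have : Complex.exp (-z) * Complex.exp z = 1 := by rw [← Complex.exp_add]; simp
    linear_combination this
  have h3 : ‖Complex.exp (-z)‖ ≤ Real.exp 2 :=
    (Complex.norm_exp_le_exp_norm _).trans (Real.exp_le_exp.2 (by simpa using hz))
  simp [Finset.sum_range_succ] at h1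
  rw [h2, norm_neg, norm_mul]
  calc _ ≤ Real.exp 2 * (‖z‖ ^ 2 * Real.exp 2) := by
        gcongr
        exact h1.trans (by gcongr)
    _ = _ := by
        rw [show (4 : ℝ) = 2 + 2 by norm_num, Real.exp_add]; ring

theorem min_one_mul_add_one_le (θ : ℝ) (j : ℕ) :
    min θ 1 * ((j : ℝ) + 1) ≤ θ + j := by
  have h1 := min_le_left θ 1
  have h2 : min θ 1 * (j : ℝ) ≤ 1 * j := by gcongr; exact min_le_right θ 1
  linarith

/-- Comparison with the harmonic numbers: the termwise difference is `(1 - θ)/((θ + j)(j + 1))`,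
which is summable. -/
theorem exists_abs_sum_inv_add_sub_log_le {θ : ℝ} (hθ : 0 < θ) :
    ∃ X : ℝ, ∀ n : ℕ, 1 ≤ n →
      |∑ j ∈ Finset.range n, 1 / (θ + j) - Real.log n| ≤ X := by
  set c := min θ 1 with hc
  have hc0 : 0 < c := lt_min hθ one_pos
  have hs := summable_add_one_rpow_neg (s := 2) (by norm_num)
  refine ⟨∑' j : ℕ, |1 - θ| / c * ((j : ℝ) + 1) ^ (-(2 : ℝ)) + 1, fun n hn => ?_⟩
  have hn' : (0 : ℝ) < n := by exact_mod_cast hn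
  have hH : (harmonic n : ℝ) = ∑ j ∈ Finset.range n, 1 / ((j : ℝ) + 1) := by
    rw [harmonic]; push_cast; simp
  have h1 := harmonic_le_one_add_log n
  have h2 := log_add_one_le_harmonic n
  have h3 : Real.log n ≤ Real.log ((n + 1 : ℕ) : ℝ) :=
    Real.log_le_log hn' (by push_cast; linarith)
  have h4 : |∑ j ∈ Finset.range n, 1 / (θ + j) - harmonic n| ≤
      ∑' j : ℕ, |1 - θ| / c * ((j : ℝ) + 1) ^ (-(2 : ℝ)) := by
    rw [hH, ← Finset.sum_sub_distrib]
    refine (Finset.abs_sum_le_sum_abs _ _).trans ?_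
    refine le_trans (Finset.sum_le_sum fun j _ => ?_)
      ((hs.mul_left (|1 - θ| / c)).sum_le_tsum (Finset.range n) fun j _ => by positivity)
    have hj : (0 : ℝ) < (j : ℝ) + 1 := by positivity
    have hθj : 0 < θ + j := by positivity
    have e : 1 / (θ + j) - 1 / ((j : ℝ) + 1) = (1 - θ) / ((θ + j) * (j + 1)) := by
      field_simp; ring
    rw [e, abs_div, abs_of_pos (mul_pos hθj hj), Real.rpow_neg hj.le, Real.rpow_two,
      div_mul_eq_mul_div, ← div_eq_mul_inv, div_div]
    refine div_le_div_of_nonneg_left (abs_nonneg _) (by positivity) ?_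
    nlinarith [min_one_mul_add_one_le θ j]
  rw [abs_le] at h4 ⊢
  constructor <;> linarith [h4.1, h4.2]

theorem summable_sq_div_add_sq {θ : ℝ} (hθ : 0 < θ) :
    Summable fun j : ℕ => (θ / (θ + j)) ^ 2 := by
  set c := min θ 1 with hc
  have hc0 : 0 < c := lt_min hθ one_pos
  have hs := summable_add_one_rpow_neg (s := 2) (by norm_num)
  refine Summable.of_nonneg_of_le (fun j => by positivity) (fun j => ?_)
    (hs.mul_left ((θ / c) ^ 2))
  have hj : (0 : ℝ) < (j : ℝ) + 1 := by positivity
  rw [Real.rpow_neg hj.le, Real.rpow_two, ← inv_pow, ← mul_pow, ← div_eq_mul_inv, div_div]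
  gcongr
  exact min_one_mul_add_one_le θ j

theorem norm_exp_sub_one_le_mul_exp (z : ℂ) :
    ‖Complex.exp z - 1‖ ≤ ‖z‖ * Real.exp ‖z‖ := by
  simpa using Complex.norm_exp_sub_sum_le_norm_mul_exp z 1

theorem real_exp_sub_one_le_mul_exp (t : ℝ) : Real.exp t - 1 ≤ t * Real.exp t := by
  have h1 := Real.add_one_le_exp (-t)
  have h2 : Real.exp (-t) * Real.exp t = 1 := by rw [← Real.exp_add]; simp
  nlinarith [Real.exp_pos t]

/-- `risingCoeff (w θ) n` is `risingCoeff θ n * exp ((w - 1) θ log n)` up to a factor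
`1 + O(w - 1)`, uniformly in `n`. -/
theorem exists_risingCoeff_eq_mul_exp {θ : ℝ} (hθ : 0 < θ) :
    ∃ C : ℝ, 0 ≤ C ∧ ∀ w : ℂ, ‖w‖ ≤ 1 → ∀ n : ℕ, 1 ≤ n → ∃ Ψ : ℂ, ‖Ψ - 1‖ ≤ C * ‖w - 1‖ ∧
      risingCoeff (w * θ) n =
        ((risingCoeff θ n : ℝ) : ℂ) * (Ψ * Complex.exp ((w - 1) * (θ * Real.log n : ℝ))) := by
  obtain ⟨X, hX⟩ := exists_abs_sum_inv_add_sub_log_le hθ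
  have hX0 : 0 ≤ X := (abs_nonneg _).trans (hX 1 le_rfl)
  have hQs := summable_sq_div_add_sq hθ
  set Q := Real.exp 4 * ∑' j : ℕ, (θ / (θ + j)) ^ 2 with hQ
  have hQ0 : 0 ≤ Q := mul_nonneg (Real.exp_pos _).le (tsum_nonneg fun j => by positivity)
  refine ⟨2 * Q * Real.exp (4 * Q) * Real.exp (2 * (θ * X)) + θ * X * Real.exp (2 * (θ * X)),
    by positivity, fun w hw n hn => ?_⟩
  have hw1 : ‖w - 1‖ ≤ 2 := (norm_sub_le _ _).trans (by simp; linarith)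
  set x : ℝ := ∑ j ∈ Finset.range n, 1 / (θ + j) - Real.log n with hx
  set z : ℕ → ℂ := fun j => (w - 1) * ((θ / (θ + j) : ℝ) : ℂ) with hz
  have hzn : ∀ j, ‖z j‖ = ‖w - 1‖ * (θ / (θ + j)) := by
    intro j
    rw [hz]
    simp only
    rw [norm_mul, Complex.norm_real, Real.norm_eq_abs, abs_of_pos (by positivity)]
  have hz2 : ∀ j, ‖z j‖ ≤ 2 := by
    intro j
    have : θ / (θ + j) ≤ 1 := by
      rw [div_le_one (by positivity)]
      linarith [(Nat.cast_nonneg j : (0 : ℝ) ≤ j)]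
    rw [hzn]
    nlinarith [norm_nonneg (w - 1)]
  -- Each factor `1 + z j` is `exp (z j)` up to a second-order relative error `ε j`. Since `∑ (θ/(θ
  -- + j))²` converges, the product `G` of the corrections stays near 1 uniformly in `n`.
  set ε : ℕ → ℂ := fun j => (1 + z j) * Complex.exp (-z j) - 1 with hε
  set G := ∏ j ∈ Finset.range n, (1 + ε j) with hG
  have hsumε : ∑ j ∈ Finset.range n, ‖ε j‖ ≤ ‖w - 1‖ ^ 2 * Q := by
    calc _ ≤ ∑ j ∈ Finset.range n, Real.exp 4 * ‖w - 1‖ ^ 2 * (θ / (θ + j)) ^ 2 := by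
          refine Finset.sum_le_sum fun j _ => ?_
          refine (norm_one_add_mul_exp_neg_sub_one_le (hz2 j)).trans_eq ?_
          rw [hzn]; ring
      _ ≤ Real.exp 4 * ‖w - 1‖ ^ 2 * ∑' j : ℕ, (θ / (θ + j)) ^ 2 := by
          rw [← Finset.mul_sum]
          gcongr
          exact hQs.sum_le_tsum _ fun j _ => by positivity
      _ = _ := by rw [hQ]; ring
  have hG1 : ‖G - 1‖ ≤ 2 * Q * Real.exp (4 * Q) * ‖w - 1‖ := by
    refine (Finset.norm_prod_one_add_sub_one_le _ _).trans ?_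
    have h4 : ‖w - 1‖ ^ 2 * Q ≤ 4 * Q := by
      gcongr
      nlinarith [norm_nonneg (w - 1)]
    have h5 : ‖w - 1‖ ^ 2 * Q ≤ 2 * Q * ‖w - 1‖ := by
      nlinarith [mul_nonneg hQ0 (norm_nonneg (w - 1)), norm_nonneg (w - 1)]
    refine (real_exp_sub_one_le_mul_exp _).trans ?_
    calc _ ≤ (2 * Q * ‖w - 1‖) * Real.exp (4 * Q) := by
          gcongr
          · exact hsumε.trans h5
          · exact hsumε.trans h4
      _ = _ := by ring
  -- `E` corrects for replacing `∑ 1/(θ + j)` by `log n`, an error `x` bounded in `n`.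
  set E := Complex.exp ((w - 1) * ((θ * x : ℝ) : ℂ)) with hE
  have hyn : ‖(w - 1) * ((θ * x : ℝ) : ℂ)‖ ≤ ‖w - 1‖ * (θ * X) := by
    rw [norm_mul, Complex.norm_real, Real.norm_eq_abs, abs_mul, abs_of_pos hθ]
    gcongr
    exact hX n hn
  have hyn2 : ‖(w - 1) * ((θ * x : ℝ) : ℂ)‖ ≤ 2 * (θ * X) := hyn.trans (by gcongr)
  have hE1 : ‖E - 1‖ ≤ θ * X * Real.exp (2 * (θ * X)) * ‖w - 1‖ := by
    refine (norm_exp_sub_one_le_mul_exp _).trans ?_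
    calc _ ≤ (‖w - 1‖ * (θ * X)) * Real.exp (2 * (θ * X)) := by gcongr
      _ = _ := by ring
  have hEn : ‖E‖ ≤ Real.exp (2 * (θ * X)) :=
    (Complex.norm_exp_le_exp_norm _).trans (Real.exp_le_exp.2 hyn2)
  refine ⟨G * E, ?_, ?_⟩
  · calc ‖G * E - 1‖ = ‖(G - 1) * E + (E - 1)‖ := by congr 1; ring
      _ ≤ ‖G - 1‖ * ‖E‖ + ‖E - 1‖ := (norm_add_le _ _).trans_eq (by rw [norm_mul])
      _ ≤ (2 * Q * Real.exp (4 * Q) * ‖w - 1‖) * Real.exp (2 * (θ * X)) +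
          θ * X * Real.exp (2 * (θ * X)) * ‖w - 1‖ := by gcongr
      _ = _ := by ring
  · have hprod : G * Complex.exp (∑ j ∈ Finset.range n, z j) =
        ∏ j ∈ Finset.range n, (1 + z j) := by
      rw [Complex.exp_sum, hG, ← Finset.prod_mul_distrib]
      refine Finset.prod_congr rfl fun j _ => ?_
      rw [hε]
      simp only
      have : Complex.exp (-z j) * Complex.exp (z j) = 1 := by rw [← Complex.exp_add]; simp
      linear_combination (1 + z j) * this
    have hexp : E * Complex.exp ((w - 1) * (θ * Real.log n : ℝ)) =
        Complex.exp (∑ j ∈ Finset.range n, z j) := by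
      rw [hE, ← Complex.exp_add]
      congr 1
      rw [hz, ← Finset.mul_sum, ← mul_add]
      congr 1
      have : ∑ j ∈ Finset.range n, θ / (θ + j) = θ * x + θ * Real.log n := by
        rw [hx, mul_sub, sub_add_cancel, Finset.mul_sum]
        exact Finset.sum_congr rfl fun j _ => by ring
      rw [← Complex.ofReal_sum, this]
      push_cast
      ring
    rw [mul_assoc, hexp, hprod, risingCoeff, risingCoeff]
    push_cast
    rw [← Finset.prod_mul_distrib]
    refine Finset.prod_congr rfl fun j _ => ?_
    have h1 : (j : ℂ) + 1 ≠ 0 := by exact_mod_cast j.succ_ne_zero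
    have h2 : (θ : ℂ) + j ≠ 0 := by exact_mod_cast (by positivity : θ + j ≠ 0)
    rw [hz]
    simp only
    push_cast
    field_simp
    ring

/-! ### The generating function of the weighted permutation sums -/

/-- The weight `∏ i, y i ^ c i / (c i)!` of a multiset in which `i` occurs `c i` times. -/
def multisetWeight (y : ℕ → ℂ) (s : Multiset ℕ) : ℂ :=
  ∏ i ∈ s.toFinset, y i ^ s.count i / (s.count i)!

theorem multisetWeight_eq_prod {y : ℕ → ℂ} {s : Multiset ℕ} {T : Finset ℕ}
    (h : s.toFinset ⊆ T) : multisetWeight y s = ∏ i ∈ T, y i ^ s.count i / (s.count i)! := by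
  refine Finset.prod_subset h fun i _ hi => ?_
  have : s.count i = 0 := Multiset.count_eq_zero.2 (by simpa using hi)
  simp [this]

theorem count_mul_multisetWeight_cons (y : ℕ → ℂ) (m : ℕ) (s : Multiset ℕ) :
    ((m ::ₘ s).count m : ℂ) * multisetWeight y (m ::ₘ s) = y m * multisetWeight y s := by
  have hm : m ∈ (m ::ₘ s).toFinset := by simp
  have hsub : s.toFinset ⊆ (m ::ₘ s).toFinset := by
    intro i hi
    simp only [Multiset.mem_toFinset, Multiset.mem_cons] at hi ⊢
    exact Or.inr hi
  rw [multisetWeight_eq_prod hsub, multisetWeight, ← Finset.mul_prod_erase _ _ hm,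
    ← Finset.mul_prod_erase _ _ hm]
  have hrest : ∏ i ∈ (m ::ₘ s).toFinset.erase m,
      y i ^ (m ::ₘ s).count i / ((m ::ₘ s).count i)! =
      ∏ i ∈ (m ::ₘ s).toFinset.erase m, y i ^ s.count i / (s.count i)! := by
    refine Finset.prod_congr rfl fun i hi => ?_
    rw [Multiset.count_cons_of_ne (Finset.ne_of_mem_erase hi)]
  rw [hrest, Multiset.count_cons_self, Nat.factorial_succ]
  have h1 : ((s.count m + 1 : ℕ) : ℂ) ≠ 0 := Nat.cast_ne_zero.2 (Nat.succ_ne_zero _)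
  have h2 : ((s.count m)! : ℂ) ≠ 0 := by exact_mod_cast Nat.factorial_ne_zero _
  push_cast at h1 ⊢
  field_simp
  ring

/-- The sum of the weights of all partitions of `n`. -/
def partitionSum (y : ℕ → ℂ) (n : ℕ) : ℂ :=
  ∑ p : n.Partition, multisetWeight y p.parts

/-- Deleting one part `m` is a bijection from the partitions of `n` containing `m` to the partitions
of `n - m`; the multiplicity cancels the top factor of the factorial in the weight. -/
theorem sum_count_mul_multisetWeight (y : ℕ → ℂ) {m n : ℕ} (hm : 1 ≤ m) (hmn : m ≤ n) :
    ∑ p : n.Partition, (p.parts.count m : ℂ) * multisetWeight y p.parts =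
      y m * partitionSum y (n - m) := by
  classical
  have h1 : ∑ p : n.Partition, (p.parts.count m : ℂ) * multisetWeight y p.parts =
      ∑ p : {p : n.Partition // m ∈ p.parts},
        (p.1.parts.count m : ℂ) * multisetWeight y p.1.parts := by
    rw [← Finset.sum_subtype (Finset.univ.filter fun p : n.Partition => m ∈ p.parts)
      (fun p => by simp) (fun p => (p.parts.count m : ℂ) * multisetWeight y p.parts)]
    refine (Finset.sum_subset (Finset.filter_subset _ _) fun p _ hp => ?_).symm
    have : p.parts.count m = 0 := Multiset.count_eq_zero.2 (by simpa using hp)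
    simp [this]
  rw [h1, partitionSum, Finset.mul_sum]
  refine Fintype.sum_equiv (Nat.Partition.partitionWithPartEquiv hm hmn) _ _ fun p => ?_
  rw [Nat.Partition.partitionWithPartEquiv_apply_parts, ← count_mul_multisetWeight_cons,
    Multiset.cons_erase p.2]

/-- Weighting each partition of `n + 1` by the total `n + 1 = ∑ m * count m` of its parts and
exchanging the sums gives exactly the recursion of `P' = x' P`. -/
theorem isExpSeries_partitionSum (y : ℕ → ℂ) :
    IsExpSeries (PowerSeries.mk y) (PowerSeries.mk (partitionSum y)) := by
  refine IsExpSeries.of_coeff ?_ fun n => ?_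
  · simp [partitionSum, multisetWeight]
  simp only [PowerSeries.coeff_mk]
  have h1 : partitionSum y (n + 1) * (n + 1) = ∑ p : (n + 1).Partition,
      ∑ m ∈ Finset.Icc 1 (n + 1), (m : ℂ) * ((p.parts.count m : ℂ) * multisetWeight y p.parts) := by
    rw [partitionSum, Finset.sum_mul]
    refine Finset.sum_congr rfl fun p _ => ?_
    have h2 : ∑ m ∈ Finset.Icc 1 (n + 1), p.parts.count m * m = n + 1 := by
      have h3 := Finset.sum_multiset_count p.parts
      rw [p.parts_sum] at h3
      refine Eq.trans (Eq.symm ?_) h3.symm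
      refine Finset.sum_subset ?_ fun i _ hi => ?_
      · intro i hi
        have hi := Multiset.mem_toFinset.1 hi
        exact Finset.mem_Icc.2 ⟨p.parts_pos hi, p.le_of_mem_parts hi⟩
      · have : p.parts.count i = 0 := Multiset.count_eq_zero.2 (by simpa using hi)
        simp [this]
    have h4 : ((n : ℂ) + 1) = ∑ m ∈ Finset.Icc 1 (n + 1), (p.parts.count m : ℂ) * m := by
      exact_mod_cast h2.symm
    rw [h4, Finset.mul_sum]
    exact Finset.sum_congr rfl fun m _ => by ring
  rw [h1, Finset.sum_comm, Finset.Nat.sum_antidiagonal_eq_sum_range_succ_mk]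
  simp_rw [← Finset.mul_sum]
  rw [Finset.range_eq_Ico, ← Finset.Ico_add_one_right_eq_Icc, Finset.sum_Ico_eq_sum_range,
    Finset.sum_Ico_eq_sum_range]
  refine Finset.sum_congr (by simp) fun i hi => ?_
  have hi' : i < n + 1 := by simpa using hi
  rw [sum_count_mul_multisetWeight y (by omega) (by omega)]
  simp only [zero_add]
  rw [show n + 1 - (1 + i) = n - i by omega, add_comm 1 i]
  push_cast
  ring

/-! ### From partitions to permutations with prescribed cycle lengths. -/

section CycleType

variable {α : Type*} [Fintype α] [DecidableEq α]

theorem parts_eq_filter_add_replicate {n : ℕ} (p : n.Partition) :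
    p.parts = p.parts.filter (2 ≤ ·) + Multiset.replicate (p.parts.count 1) 1 := by
  conv_lhs => rw [← Multiset.filter_add_not (2 ≤ ·) p.parts]
  congr 1
  rw [← Multiset.filter_eq']
  refine Multiset.filter_congr fun x hx => ?_
  have := p.parts_pos hx
  omega

theorem count_one_eq_sub {n : ℕ} (p : n.Partition) :
    p.parts.count 1 = n - (p.parts.filter (2 ≤ ·)).sum := by
  have h := congrArg Multiset.sum (parts_eq_filter_add_replicate p)
  rw [p.parts_sum, Multiset.sum_add, Multiset.sum_replicate] at h
  simp only [smul_eq_mul, mul_one] at h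
  omega

/-- The number of parts equal to 1 is forced by the remaining parts, so forgetting fixed points, as
`cycleType` does, loses nothing. -/
theorem partition_eq_iff_cycleType_eq (σ : Equiv.Perm α) (p : (Fintype.card α).Partition) :
    σ.partition = p ↔ σ.cycleType = p.parts.filter (2 ≤ ·) := by
  constructor
  · rintro rfl
    exact Equiv.Perm.filter_parts_partition_eq_cycleType.symm
  · intro h
    refine Nat.Partition.ext ?_
    rw [Equiv.Perm.parts_partition, ← Equiv.Perm.sum_cycleType, h, ← count_one_eq_sub]
    exact (parts_eq_filter_add_replicate p).symm

theorem card_partition_eq_mul (p : (Fintype.card α).Partition) :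
    (Finset.univ.filter fun σ : Equiv.Perm α => σ.partition = p).card *
      ∏ m ∈ Finset.Icc 1 (Fintype.card α), (m ^ p.parts.count m * (p.parts.count m)!) =
      (Fintype.card α)! := by
  set q := p.parts.filter (2 ≤ ·) with hq
  have h := Equiv.Perm.card_of_cycleType_mul_eq α q
  have hqs : q.sum ≤ Fintype.card α := by
    have h := congrArg Multiset.sum (parts_eq_filter_add_replicate p)
    rw [p.parts_sum, Multiset.sum_add, ← hq] at h
    omega
  rw [if_pos ⟨hqs, fun a ha => (Multiset.mem_filter.1 ha).2⟩, hq, ← count_one_eq_sub, ← hq]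
    at h
  have hset : (Finset.univ.filter fun σ : Equiv.Perm α => σ.partition = p) =
      Finset.univ.filter fun σ : Equiv.Perm α => σ.cycleType = q :=
    Finset.filter_congr fun σ _ => partition_eq_iff_cycleType_eq σ p
  rw [hset, ← h]
  congr 1
  have hsub : q.toFinset ⊆ Finset.Icc 1 (Fintype.card α) := by
    intro i hi
    have hi := Multiset.mem_of_mem_filter (Multiset.mem_toFinset.1 hi)
    exact Finset.mem_Icc.2 ⟨p.parts_pos hi, p.le_of_mem_parts hi⟩
  have hzero : ∀ i ∉ q.toFinset, q.count i = 0 := fun i hi =>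
    Multiset.count_eq_zero.2 (by simpa using hi)
  have h1 : q.prod = ∏ m ∈ Finset.Icc 1 (Fintype.card α), m ^ q.count m := by
    rw [Finset.prod_multiset_count]
    exact Finset.prod_subset hsub fun i _ hi => by simp [hzero i hi]
  have h2 : ∏ m ∈ q.toFinset, (q.count m)! = ∏ m ∈ Finset.Icc 1 (Fintype.card α), (q.count m)! :=
    Finset.prod_subset hsub fun i _ hi => by simp [hzero i hi]
  -- In the formula for `cycleType` the fixed points contribute a separate factorial. Written as a
  -- product supported at `m = 1`, it merges with the product over the longer cycles.
  have h3 : (p.parts.count 1)! =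
      ∏ m ∈ Finset.Icc 1 (Fintype.card α), if m = 1 then (p.parts.count 1)! else 1 := by
    rw [Finset.prod_ite_eq']
    split_ifs with h1
    · rfl
    · have : p.parts.count 1 = 0 := Multiset.count_eq_zero.2 fun h =>
        h1 (Finset.mem_Icc.2 ⟨le_rfl, p.le_of_mem_parts h⟩)
      simp [this]
  rw [h1, h2, h3, ← Finset.prod_mul_distrib, ← Finset.prod_mul_distrib]
  refine Finset.prod_congr rfl fun m hm => ?_
  have hm1 := (Finset.mem_Icc.1 hm).1
  split_ifs with hm2
  · subst hm2
    have : q.count 1 = 0 := Multiset.count_eq_zero.2 fun h => by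
      have := (Multiset.mem_filter.1 h).2
      omega
    simp [this]
  · have : q.count m = p.parts.count m := Multiset.count_filter_of_pos (by omega)
    rw [this]
    ring

/-- Permutations are grouped by cycle partition. The class of `p` has `n! / ∏ m^(c_m) c_m!`
elements, and the factor `m` in front of `y m` cancels `m^(c_m)`. -/
theorem sum_perm_prod_pow_count (y : ℕ → ℂ) :
    (1 / ((Fintype.card α)! : ℂ)) * ∑ σ : Equiv.Perm α,
      ∏ m ∈ Finset.Icc 1 (Fintype.card α), (m * y m) ^ σ.partition.parts.count m =
      partitionSum y (Fintype.card α) := by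
  classical
  rw [← Finset.sum_fiberwise Finset.univ (fun σ : Equiv.Perm α => σ.partition), Finset.mul_sum,
    partitionSum]
  refine Finset.sum_congr rfl fun p _ => ?_
  have h1 : ∀ σ ∈ Finset.univ.filter (fun σ : Equiv.Perm α => σ.partition = p),
      ∏ m ∈ Finset.Icc 1 (Fintype.card α), ((m : ℂ) * y m) ^ σ.partition.parts.count m =
      ∏ m ∈ Finset.Icc 1 (Fintype.card α), ((m : ℂ) * y m) ^ p.parts.count m := by
    intro σ hσ
    rw [(Finset.mem_filter.1 hσ).2]
  rw [Finset.sum_congr rfl h1, Finset.sum_const, nsmul_eq_mul]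
  have hsub : p.parts.toFinset ⊆ Finset.Icc 1 (Fintype.card α) := by
    intro i hi
    have hi := Multiset.mem_toFinset.1 hi
    exact Finset.mem_Icc.2 ⟨p.parts_pos hi, p.le_of_mem_parts hi⟩
  rw [multisetWeight_eq_prod hsub]
  have h2 : ((Fintype.card α)! : ℂ) ≠ 0 := by exact_mod_cast Nat.factorial_ne_zero _
  rw [one_div, inv_mul_eq_iff_eq_mul₀ h2]
  have h3 := card_partition_eq_mul p
  have h4 : ((Fintype.card α)! : ℂ) =
      ((Finset.univ.filter fun σ : Equiv.Perm α => σ.partition = p).card : ℂ) *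
      ∏ m ∈ Finset.Icc 1 (Fintype.card α),
        ((m : ℂ) ^ p.parts.count m * ((p.parts.count m)! : ℂ)) := by
    rw [← h3]; push_cast; rfl
  rw [h4, mul_assoc, ← Finset.prod_mul_distrib]
  congr 1
  refine Finset.prod_congr rfl fun m _ => ?_
  have h5 : ((p.parts.count m)! : ℂ) ≠ 0 := by exact_mod_cast Nat.factorial_ne_zero _
  rw [mul_pow]
  field_simp

end CycleType

theorem sum_Icc_mul_cycleCount {n : ℕ} (σ : Equiv.Perm (Fin n)) :
    ∑ m ∈ Finset.Icc 1 n, m * cycleCount m σ = n := by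
  have h3 := Finset.sum_multiset_count σ.partition.parts
  rw [σ.partition.parts_sum] at h3
  have h4 : ∑ m ∈ σ.partition.parts.toFinset, σ.partition.parts.count m • m =
      ∑ m ∈ Finset.Icc 1 n, σ.partition.parts.count m • m := by
    refine Finset.sum_subset ?_ fun i _ hi => ?_
    · intro i hi
      have hi := Multiset.mem_toFinset.1 hi
      have := σ.partition.le_of_mem_parts hi
      rw [Fintype.card_fin] at this
      exact Finset.mem_Icc.2 ⟨σ.partition.parts_pos hi, this⟩
    · have : σ.partition.parts.count i = 0 := Multiset.count_eq_zero.2 (by simpa using hi)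
      simp [this]
  rw [h4] at h3
  simp only [Fintype.card_fin, smul_eq_mul] at h3
  refine Eq.trans ?_ h3.symm
  exact Finset.sum_congr rfl fun m _ => mul_comm _ _

/-- The exponential formula for weighted permutations. -/
theorem isExpSeries_sum_perm (Θ : ℕ → ℝ) (r : ℝ) (w : ℂ) :
    IsExpSeries (PowerSeries.mk fun k : ℕ => w * ((Θ k * r ^ k / k : ℝ) : ℂ))
      (PowerSeries.mk fun n : ℕ => (r : ℂ) ^ n * ((1 / (n ! : ℂ)) *
        ∑ σ : Equiv.Perm (Fin n), w ^ totalCycles σ * (cycleWeight Θ σ : ℂ))) := by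
  convert isExpSeries_partitionSum (fun k : ℕ => w * ((Θ k * r ^ k / k : ℝ) : ℂ)) using 2
  ext n
  have h := sum_perm_prod_pow_count (α := Fin n) (fun k : ℕ => w * ((Θ k * r ^ k / k : ℝ) : ℂ))
  simp only [Fintype.card_fin] at h
  rw [← h, mul_left_comm, Finset.mul_sum]
  congr 1
  refine Finset.sum_congr rfl fun σ _ => ?_
  have h1 : ∀ m ∈ Finset.Icc 1 n, ((m : ℂ) * (w * ((Θ m * r ^ m / m : ℝ) : ℂ))) ^
      σ.partition.parts.count m =
      w ^ cycleCount m σ * (Θ m : ℂ) ^ cycleCount m σ * (r : ℂ) ^ (m * cycleCount m σ) := by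
    intro m hm
    have : (m : ℂ) ≠ 0 := by
      have := (Finset.mem_Icc.1 hm).1
      exact_mod_cast (by omega : m ≠ 0)
    rw [cycleCount, pow_mul, ← mul_pow, ← mul_pow]
    congr 1
    push_cast
    field_simp
  rw [Finset.prod_congr rfl h1, Finset.prod_mul_distrib, Finset.prod_mul_distrib,
    Finset.prod_pow_eq_pow_sum, Finset.prod_pow_eq_pow_sum, sum_Icc_mul_cycleCount, totalCycles,
    cycleWeight]
  push_cast
  ring

/-! ### Fourier inversion for sequences and the resulting bounds -/

theorem integral_exp_intCast_mul_I (m : ℤ) :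
    ∫ s in (-Real.pi)..Real.pi, Complex.exp (((m * s : ℝ) : ℂ) * Complex.I) =
      if m = 0 then (2 * Real.pi : ℂ) else 0 := by
  split_ifs with h
  · subst h
    simp
    ring
  · have hc : ((m : ℂ) * Complex.I) ≠ 0 := by
      simp [h]
    have h1 := integral_exp_mul_complex (a := -Real.pi) (b := Real.pi) hc
    have h2 : ∀ s : ℝ, Complex.exp (((m * s : ℝ) : ℂ) * Complex.I) =
        Complex.exp ((m : ℂ) * Complex.I * s) := by
      intro s; congr 1; push_cast; ring
    simp_rw [h2]
    rw [h1, div_eq_zero_iff]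
    left
    rw [sub_eq_zero]
    have := Complex.exp_periodic.int_mul m ((m : ℂ) * Complex.I * ((-Real.pi : ℝ) : ℂ))
    rw [← this]
    congr 1
    push_cast
    ring

/-- The characteristic function of the sequence `d`. -/
def charSum (d : ℕ → ℝ) (s : ℝ) : ℂ := ∑' k : ℕ, (d k : ℂ) * Complex.exp (((k * s : ℝ) : ℂ) * Complex.I)

theorem hasSum_charSum {d : ℕ → ℝ} (hd : Summable d) (s : ℝ) :
    HasSum (fun k : ℕ => (d k : ℂ) * Complex.exp (((k * s : ℝ) : ℂ) * Complex.I))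
      (charSum d s) := by
  refine Summable.hasSum (Summable.of_norm_bounded hd.abs fun k => ?_)
  rw [norm_mul, Complex.norm_exp_ofReal_mul_I, mul_one, Complex.norm_real, Real.norm_eq_abs]

theorem integral_charSum_mul_exp {d : ℕ → ℝ} (hd : Summable d) (j : ℕ) :
    ∫ s in (-Real.pi)..Real.pi, charSum d s * Complex.exp (((-j * s : ℝ) : ℂ) * Complex.I) =
      2 * Real.pi * d j := by
  have hterm : ∀ (k : ℕ) (s : ℝ), (d k : ℂ) * Complex.exp (((k * s : ℝ) : ℂ) * Complex.I) *
      Complex.exp (((-j * s : ℝ) : ℂ) * Complex.I) =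
      (d k : ℂ) * Complex.exp (((((k : ℤ) - j : ℤ) * s : ℝ) : ℂ) * Complex.I) := by
    intro k s
    rw [mul_assoc, ← Complex.exp_add]
    congr 2
    push_cast
    ring
  have h := intervalIntegral.hasSum_integral_of_dominated_convergence
    (μ := volume) (a := -Real.pi) (b := Real.pi)
    (F := fun (k : ℕ) (s : ℝ) =>
      (d k : ℂ) * Complex.exp (((((k : ℤ) - j : ℤ) * s : ℝ) : ℂ) * Complex.I))
    (f := fun s => charSum d s * Complex.exp (((-j * s : ℝ) : ℂ) * Complex.I))
    (fun k _ => |d k|)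
    (fun k => (Continuous.aestronglyMeasurable (by fun_prop)))
    (fun k => Eventually.of_forall fun s _ => by
      rw [norm_mul, Complex.norm_exp_ofReal_mul_I, mul_one, Complex.norm_real, Real.norm_eq_abs])
    (Eventually.of_forall fun s _ => hd.abs)
    (intervalIntegrable_const)
    (Eventually.of_forall fun s _ => by
      have := (hasSum_charSum hd s).mul_right (Complex.exp (((-j * s : ℝ) : ℂ) * Complex.I))
      simpa only [hterm] using this)
  rw [← h.tsum_eq, tsum_eq_single j]
  · rw [intervalIntegral.integral_const_mul, integral_exp_intCast_mul_I]
    simp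
    ring
  · intro k hk
    rw [intervalIntegral.integral_const_mul, integral_exp_intCast_mul_I,
      if_neg (by omega), mul_zero]

theorem continuous_charSum {d : ℕ → ℝ} (hd : Summable d) : Continuous (charSum d) := by
  refine continuous_tsum (fun k => by fun_prop) hd.abs fun k s => ?_
  rw [norm_mul, Complex.norm_exp_ofReal_mul_I, mul_one, Complex.norm_real, Real.norm_eq_abs]

theorem integral_charSum_mul_sum_exp {d : ℕ → ℝ} (hd : Summable d) (m : ℕ) :
    ∫ s in (-Real.pi)..Real.pi, charSum d s *
        ∑ j ∈ Finset.range m, Complex.exp (((-j * s : ℝ) : ℂ) * Complex.I) =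
      2 * Real.pi * ((∑ j ∈ Finset.range m, d j : ℝ) : ℂ) := by
  simp_rw [Finset.mul_sum]
  have hc := continuous_charSum hd
  rw [intervalIntegral.integral_finsetSum]
  · simp_rw [integral_charSum_mul_exp hd]
    rw [← Finset.mul_sum]
    push_cast
    rfl
  · intro j _
    exact Continuous.intervalIntegrable (by fun_prop) _ _

theorem two_div_pi_mul_abs_le_norm_exp_sub_one {s : ℝ} (hs : |s| ≤ Real.pi) :
    2 / Real.pi * |s| ≤ ‖Complex.exp ((s : ℂ) * Complex.I) - 1‖ := by
  rw [mul_comm (s : ℂ), Complex.norm_exp_I_mul_ofReal_sub_one, norm_mul, Real.norm_eq_abs,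
    Real.norm_eq_abs, abs_of_pos (two_pos : (0 : ℝ) < 2)]
  have := Real.mul_abs_le_abs_sin (x := s / 2) (by rw [abs_div]; simp; linarith)
  rw [abs_div, abs_of_pos (two_pos : (0 : ℝ) < 2)] at this
  linarith

theorem le_rpow_mul_rpow {x y z p : ℝ} (hz : 0 ≤ z) (hx : z ≤ x) (hy : z ≤ y) (hp : 0 ≤ p)
    (hp1 : p ≤ 1) : z ≤ x ^ (1 - p) * y ^ p := by
  rcases hz.eq_or_lt with rfl | hz'
  · positivity
  calc z = z ^ (1 - p) * z ^ p := by rw [← Real.rpow_add hz']; simp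
    _ ≤ _ := by
      have h1 : 0 ≤ 1 - p := by linarith
      have h2 : 0 ≤ x := hz.trans hx
      gcongr

/-- Interpolation between the trivial bound `m` and the geometric-sum bound `π/|s|`. The latter is
not integrable at 0, but its powers with `p < 1` are. -/
theorem norm_sum_exp_le {s p : ℝ} (hs : |s| ≤ Real.pi) (hs0 : s ≠ 0) (hp : 0 ≤ p) (hp1 : p ≤ 1)
    (m : ℕ) :
    ‖∑ j ∈ Finset.range m, Complex.exp (((-j * s : ℝ) : ℂ) * Complex.I)‖ ≤
      (m : ℝ) ^ (1 - p) * (Real.pi / |s|) ^ p := by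
  have hs' : 0 < |s| := abs_pos.2 hs0
  refine le_rpow_mul_rpow (norm_nonneg _) ?_ ?_ hp hp1
  · refine (norm_sum_le _ _).trans ?_
    simp only [Complex.norm_exp_ofReal_mul_I]
    simp
  · have hgeom : ∀ j : ℕ, Complex.exp (((-j * s : ℝ) : ℂ) * Complex.I) =
        Complex.exp (((-s : ℝ) : ℂ) * Complex.I) ^ j := by
      intro j
      rw [← Complex.exp_nat_mul]
      congr 1
      push_cast
      ring
    have hlow := two_div_pi_mul_abs_le_norm_exp_sub_one (s := -s) (by rwa [abs_neg])
    rw [abs_neg] at hlow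
    have hpos : 0 < 2 / Real.pi * |s| := by positivity
    set q := Complex.exp (((-s : ℝ) : ℂ) * Complex.I) with hq
    have hq1 : q ≠ 1 := by
      intro h
      rw [h] at hlow
      simp at hlow
      exact hs0 (by
        by_contra
        have := hpos
        linarith)
    simp_rw [hgeom]
    rw [geom_sum_eq hq1, norm_div]
    have hnum : ‖q ^ m - 1‖ ≤ 2 := by
      refine (norm_sub_le _ _).trans ?_
      rw [norm_pow, hq, Complex.norm_exp_ofReal_mul_I]
      norm_num
    calc _ ≤ 2 / (2 / Real.pi * |s|) := by gcongr
      _ = _ := by field_simp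

theorem integral_comp_abs_symm {f : ℝ → ℝ} {c : ℝ} (hc : 0 ≤ c)
    (hf : IntervalIntegrable f volume 0 c) :
    IntervalIntegrable (fun s => f |s|) volume (-c) c ∧
      ∫ s in (-c)..c, f |s| = 2 * ∫ s in (0)..c, f s := by
  have h1 : IntervalIntegrable (fun s => f |s|) volume 0 c := by
    refine hf.congr fun s hs => ?_
    rw [Set.uIoc_of_le hc] at hs
    rw [abs_of_pos hs.1]
  have h1i : ∫ s in (0)..c, f |s| = ∫ s in (0)..c, f s := by
    refine intervalIntegral.integral_congr fun s hs => ?_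
    rw [Set.uIcc_of_le hc] at hs
    rw [abs_of_nonneg hs.1]
  have h2 : IntervalIntegrable (fun s => f |s|) volume (-c) 0 := by
    have := (IntervalIntegrable.iff_comp_neg (by simp)).1 h1
    simpa only [abs_neg, neg_zero] using this.symm
  have h2i : ∫ s in (-c)..0, f |s| = ∫ s in (0)..c, f |s| := by
    have := intervalIntegral.integral_comp_neg (a := 0) (b := c) (fun s => f |s|)
    simpa only [abs_neg, neg_zero] using this.symm
  refine ⟨h2.trans h1, ?_⟩
  rw [← intervalIntegral.integral_add_adjacent_intervals h2 h1, h2i, h1i]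
  ring

theorem integral_abs_rpow {c q : ℝ} (hc : 0 ≤ c) (hq : -1 < q) :
    IntervalIntegrable (fun s : ℝ => |s| ^ q) volume (-c) c ∧
      ∫ s in (-c)..c, |s| ^ q = 2 * (c ^ (q + 1) / (q + 1)) := by
  have h := integral_comp_abs_symm (f := fun s => s ^ q) hc
    (intervalIntegral.intervalIntegrable_rpow' hq)
  refine ⟨h.1, ?_⟩
  rw [h.2, integral_rpow (Or.inl hq), Real.zero_rpow (by linarith), sub_zero]

theorem integral_abs_mul_exp_neg_le {b : ℝ} (hb : 0 < b) :
    ∫ s in (-Real.pi)..Real.pi, |s| * Real.exp (-b * s ^ 2) ≤ 1 / b := by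
  have h := (integral_comp_abs_symm (f := fun s => s * Real.exp (-b * s ^ 2)) Real.pi_pos.le
    (Continuous.intervalIntegrable (by fun_prop) _ _)).2
  simp only [sq_abs] at h
  have h2 : ∫ s in (0)..Real.pi, s * Real.exp (-b * s ^ 2) =
      -Real.exp (-b * Real.pi ^ 2) / (2 * b) - -Real.exp (-b * 0 ^ 2) / (2 * b) := by
    refine intervalIntegral.integral_eq_sub_of_hasDerivAt
      (f := fun s => -Real.exp (-b * s ^ 2) / (2 * b)) (fun s _ => ?_)
      (Continuous.intervalIntegrable (by fun_prop) _ _)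
    have h3 : HasDerivAt (fun s : ℝ => -b * s ^ 2) (-b * (2 * s)) s := by
      simpa using (hasDerivAt_pow 2 s).const_mul (-b)
    refine (h3.exp.neg.div_const (2 * b)).congr_deriv ?_
    field_simp
  rw [h, h2]
  have := Real.exp_pos (-b * Real.pi ^ 2)
  have e : 2 * (-Real.exp (-b * Real.pi ^ 2) / (2 * b) - -Real.exp (-b * 0 ^ 2) / (2 * b)) =
      (1 - Real.exp (-b * Real.pi ^ 2)) / b := by
    simp; field_simp; ring
  rw [e]
  gcongr
  linarith

theorem integral_exp_neg_sq_le {b : ℝ} (hb : 0 < b) :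
    ∫ s in (-Real.pi)..Real.pi, Real.exp (-b * s ^ 2) ≤ √(Real.pi / b) := by
  rw [← integral_gaussian, intervalIntegral.integral_of_le (by linarith [Real.pi_pos])]
  exact setIntegral_le_integral (integrable_exp_neg_mul_sq hb)
    (Eventually.of_forall fun s => (Real.exp_pos _).le)

theorem mem_Ioc_pi_abs_le {s : ℝ} (hs : s ∈ Set.Ioc (-Real.pi) Real.pi) : |s| ≤ Real.pi :=
  abs_le.2 ⟨hs.1.le, hs.2⟩

theorem abs_le_of_norm_charSum_le {d : ℕ → ℝ} (hd : Summable d) {a b e : ℝ} (ha : 0 ≤ a)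
    (hb : 0 < b)
    (h : ∀ s : ℝ, |s| ≤ Real.pi → ‖charSum d s‖ ≤ a * (|s| * Real.exp (-b * s ^ 2)) + e) (j : ℕ) :
    |d j| ≤ a / b + e := by
  have h1 : ‖(2 * Real.pi * d j : ℂ)‖ ≤ ∫ s in (-Real.pi)..Real.pi,
      (a * (|s| * Real.exp (-b * s ^ 2)) + e) := by
    rw [← integral_charSum_mul_exp hd]
    refine intervalIntegral.norm_integral_le_of_norm_le (by linarith [Real.pi_pos])
      (Eventually.of_forall fun s hs => ?_) (Continuous.intervalIntegrable (by fun_prop) _ _)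
    rw [norm_mul, Complex.norm_exp_ofReal_mul_I, mul_one]
    exact h s (mem_Ioc_pi_abs_le hs)
  rw [intervalIntegral.integral_add (Continuous.intervalIntegrable (by fun_prop) _ _)
    (Continuous.intervalIntegrable (by fun_prop) _ _), intervalIntegral.integral_const_mul,
    intervalIntegral.integral_const] at h1
  have h2 := mul_le_mul_of_nonneg_left (integral_abs_mul_exp_neg_le hb) ha
  have h3 : ‖(2 * Real.pi * d j : ℂ)‖ = 2 * Real.pi * |d j| := by
    simp [abs_of_pos Real.pi_pos]
  rw [h3] at h1
  simp only [smul_eq_mul] at h1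
  have hpi := Real.pi_gt_three
  have h4 : 2 * Real.pi * |d j| ≤ 2 * Real.pi * (a / b + e) := by
    have : 0 ≤ a / b := by positivity
    have e1 : a * (1 / b) = a / b := by ring
    rw [e1] at h2
    nlinarith
  exact le_of_mul_le_mul_left h4 (by positivity)

/-- The kernel is bounded by `π/|s|` against the Gaussian part, whose factor `|s|` cancels it, and
by the interpolated bound against `e`, which need not vanish at `s = 0`. The price is the power
`m^(1-p)`. -/
theorem abs_sum_le_of_norm_charSum_le {d : ℕ → ℝ} (hd : Summable d) {a b e p : ℝ} (ha : 0 ≤ a)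
    (hb : 0 < b) (he : 0 ≤ e) (hp : 0 ≤ p) (hp1 : p < 1)
    (h : ∀ s : ℝ, |s| ≤ Real.pi → ‖charSum d s‖ ≤ a * (|s| * Real.exp (-b * s ^ 2)) + e) (m : ℕ) :
    |∑ j ∈ Finset.range m, d j| ≤ a * √(Real.pi / b) + e * ((m : ℝ) ^ (1 - p) *
      (Real.pi / (1 - p))) := by
  have hpi := Real.pi_gt_three
  have hint := integral_abs_rpow Real.pi_pos.le (q := -p) (by linarith)
  set c := e * ((m : ℝ) ^ (1 - p) * Real.pi ^ p) with hc
  have h1 : ‖(2 * Real.pi * ((∑ j ∈ Finset.range m, d j : ℝ) : ℂ) : ℂ)‖ ≤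
      ∫ s in (-Real.pi)..Real.pi, (a * Real.pi * Real.exp (-b * s ^ 2) + c * |s| ^ (-p)) := by
    rw [← integral_charSum_mul_sum_exp hd]
    have hne : ∀ᵐ s : ℝ, s ≠ 0 := by
      simpa using (MeasureTheory.Measure.ae_ne volume (0 : ℝ))
    refine intervalIntegral.norm_integral_le_of_norm_le (by linarith [Real.pi_pos])
      (hne.mono fun s hs0 hs => ?_)
      ((Continuous.intervalIntegrable (by fun_prop) _ _).add (hint.1.const_mul c))
    have hs' := mem_Ioc_pi_abs_le hs
    have hsp : 0 < |s| := abs_pos.2 hs0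
    have k1 := norm_sum_exp_le hs' hs0 zero_le_one le_rfl m
    have k2 := norm_sum_exp_le hs' hs0 hp hp1.le m
    simp only [sub_self, Real.rpow_zero, one_mul, Real.rpow_one] at k1
    rw [norm_mul]
    refine (mul_le_mul_of_nonneg_right (h s hs') (norm_nonneg _)).trans ?_
    rw [add_mul]
    refine add_le_add ?_ ?_
    · calc _ ≤ a * (|s| * Real.exp (-b * s ^ 2)) * (Real.pi / |s|) := by gcongr
        _ = _ := by field_simp
    · calc _ ≤ e * ((m : ℝ) ^ (1 - p) * (Real.pi / |s|) ^ p) := by gcongr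
        _ = _ := by
          rw [hc, Real.div_rpow Real.pi_pos.le hsp.le, Real.rpow_neg hsp.le]
          ring
  rw [intervalIntegral.integral_add (Continuous.intervalIntegrable (by fun_prop) _ _)
    (hint.1.const_mul c), intervalIntegral.integral_const_mul,
    intervalIntegral.integral_const_mul, hint.2] at h1
  have h2 := mul_le_mul_of_nonneg_left (integral_exp_neg_sq_le hb)
    (mul_nonneg ha Real.pi_pos.le)
  have h3 : ‖(2 * Real.pi * ((∑ j ∈ Finset.range m, d j : ℝ) : ℂ) : ℂ)‖ =
      2 * Real.pi * |∑ j ∈ Finset.range m, d j| := by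
    rw [norm_mul, Complex.norm_real, Real.norm_eq_abs]
    simp [abs_of_pos Real.pi_pos]
  rw [h3] at h1
  have hq : 0 < 1 - p := by linarith
  have h4 : c * (2 * (Real.pi ^ (-p + 1) / (-p + 1))) =
      2 * Real.pi * (e * ((m : ℝ) ^ (1 - p) * (1 / (1 - p)))) := by
    have : Real.pi ^ p * Real.pi ^ (-p + 1) = Real.pi := by
      rw [← Real.rpow_add Real.pi_pos]; simp
    rw [hc, show -p + 1 = 1 - p by ring] at *
    field_simp
    linear_combination (e * (m : ℝ) ^ (1 - p)) * this
  rw [h4] at h1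
  have h5 : 2 * Real.pi * |∑ j ∈ Finset.range m, d j| ≤ 2 * Real.pi *
      (a * √(Real.pi / b) + e * ((m : ℝ) ^ (1 - p) * (1 / (1 - p)))) := by
    have : 0 ≤ a * √(Real.pi / b) := by positivity
    nlinarith
  refine (le_of_mul_le_mul_left h5 (by positivity)).trans ?_
  gcongr
  linarith

/-! ### Distances between laws on `ℕ` viewed on `ℤ` -/

theorem real_map_natCast_singleton (ν : Measure ℕ) (k : ℕ) :
    (ν.map fun k : ℕ => (k : ℤ)).real {(k : ℤ)} = ν.real {k} := by
  rw [map_measureReal_apply (by fun_prop) (measurableSet_singleton _)]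
  congr 1
  ext i
  simp

theorem real_map_natCast_Iic (ν : Measure ℕ) (k : ℕ) :
    (ν.map fun k : ℕ => (k : ℤ)).real (Set.Iic (k : ℤ)) = ν.real (Set.Iic k) := by
  rw [map_measureReal_apply (by fun_prop) measurableSet_Iic]
  congr 1
  ext i
  simp

theorem dLoc_map_natCast_le {ν₁ ν₂ : Measure ℕ} {c : ℝ}
    (h : ∀ k, |ν₁.real {k} - ν₂.real {k}| ≤ c) :
    dLoc (ν₁.map fun k : ℕ => (k : ℤ)) (ν₂.map fun k : ℕ => (k : ℤ)) ≤ c := by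
  refine ciSup_le fun j => ?_
  rcases le_or_gt 0 j with hj | hj
  · lift j to ℕ using hj
    rw [real_map_natCast_singleton, real_map_natCast_singleton]
    exact h j
  · have h0 : (fun k : ℕ => (k : ℤ)) ⁻¹' {j} = ∅ := by
      ext i
      simp
      omega
    rw [map_measureReal_apply (by fun_prop) (measurableSet_singleton _),
      map_measureReal_apply (by fun_prop) (measurableSet_singleton _), h0]
    simpa using (abs_nonneg _).trans (h 0)

theorem dKol_map_natCast_le {ν₁ ν₂ : Measure ℕ} {c : ℝ}
    (h : ∀ k, |ν₁.real (Set.Iic k) - ν₂.real (Set.Iic k)| ≤ c) :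
    dKol (ν₁.map fun k : ℕ => (k : ℤ)) (ν₂.map fun k : ℕ => (k : ℤ)) ≤ c := by
  refine ciSup_le fun j => ?_
  rcases le_or_gt 0 j with hj | hj
  · lift j to ℕ using hj
    rw [real_map_natCast_Iic, real_map_natCast_Iic]
    exact h j
  · have h0 : (fun k : ℕ => (k : ℤ)) ⁻¹' Set.Iic j = ∅ := by
      ext i
      simp
      omega
    rw [map_measureReal_apply (by fun_prop) measurableSet_Iic,
      map_measureReal_apply (by fun_prop) measurableSet_Iic, h0]
    simpa using (abs_nonneg _).trans (h 0)

theorem real_Iic_eq_sum (ν : Measure ℕ) [IsFiniteMeasure ν] (k : ℕ) :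
    ν.real (Set.Iic k) = ∑ i ∈ Finset.range (k + 1), ν.real {i} := by
  rw [sum_measureReal_singleton]
  congr 1
  ext i
  simp

theorem abs_real_sub_real_le_one {α : Type*} [MeasurableSpace α] (μ ν : Measure α)
    [IsProbabilityMeasure μ] [IsProbabilityMeasure ν] (s : Set α) :
    |μ.real s - ν.real s| ≤ 1 := by
  have h1 : μ.real s ≤ 1 := measureReal_le_one
  have h2 : ν.real s ≤ 1 := measureReal_le_one
  have h3 : 0 ≤ μ.real s := measureReal_nonneg
  have h4 : 0 ≤ ν.real s := measureReal_nonneg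
  rw [abs_le]
  constructor <;> linarith

theorem summable_real_singleton (ν : Measure ℕ) [IsFiniteMeasure ν] :
    Summable fun k => ν.real {k} := by
  refine summable_of_sum_range_le (c := ν.real Set.univ) (fun _ => measureReal_nonneg) fun n => ?_
  rw [sum_measureReal_singleton]
  exact measureReal_mono (Set.subset_univ _)

/-! ### The law of the number of cycles -/

/-- The mass of a permutation under the weighted measure. -/
def permMass (Θ : ℕ → ℝ) {n : ℕ} (σ : Equiv.Perm (Fin n)) : ℝ :=
  1 / (hNorm Θ n * (n ! : ℝ)) * cycleWeight Θ σ

theorem cycleWeight_nonneg {Θ : ℕ → ℝ} (hΘ : ∀ m : ℕ, 1 ≤ m → 0 ≤ Θ m) {n : ℕ}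
    (σ : Equiv.Perm (Fin n)) : 0 ≤ cycleWeight Θ σ :=
  Finset.prod_nonneg fun m hm => pow_nonneg (hΘ m (Finset.mem_Icc.1 hm).1) _

theorem permMass_nonneg {Θ : ℕ → ℝ} (hΘ : ∀ m : ℕ, 1 ≤ m → 0 ≤ Θ m) {n : ℕ}
    (hn : 0 < hNorm Θ n) (σ : Equiv.Perm (Fin n)) : 0 ≤ permMass Θ σ := by
  have := cycleWeight_nonneg hΘ σ
  unfold permMass
  positivity

theorem sum_permMass {Θ : ℕ → ℝ} {n : ℕ} (hn : 0 < hNorm Θ n) :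
    ∑ σ : Equiv.Perm (Fin n), permMass Θ σ = 1 := by
  have h : ∑ σ : Equiv.Perm (Fin n), cycleWeight Θ σ = hNorm Θ n * (n ! : ℝ) := by
    have : (n ! : ℝ) ≠ 0 := by exact_mod_cast n.factorial_ne_zero
    rw [hNorm]
    field_simp
  unfold permMass
  rw [← Finset.mul_sum, h]
  have : (n ! : ℝ) ≠ 0 := by exact_mod_cast n.factorial_ne_zero
  field_simp

theorem weightedMeasure_real {Θ : ℕ → ℝ} (hΘ : ∀ m : ℕ, 1 ≤ m → 0 ≤ Θ m) {n : ℕ}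
    (hn : 0 < hNorm Θ n) (A : Set (Equiv.Perm (Fin n))) :
    (weightedMeasure Θ n).real A = ∑ σ, A.indicator (permMass Θ) σ := by
  classical
  rw [measureReal_def, weightedMeasure, Measure.finsetSum_apply, ENNReal.toReal_sum]
  · refine Finset.sum_congr rfl fun σ _ => ?_
    rw [Measure.smul_apply, Measure.dirac_apply' _ (MeasurableSpace.measurableSet_top), smul_eq_mul,
      ENNReal.toReal_mul, ← permMass, ENNReal.toReal_ofReal (permMass_nonneg hΘ hn σ)]
    by_cases h : σ ∈ A <;> simp [h, permMass]
  · intro σ _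
    rw [Measure.smul_apply, smul_eq_mul]
    exact ENNReal.mul_ne_top ENNReal.ofReal_ne_top (measure_ne_top _ _)

theorem isProbabilityMeasure_weightedMeasure {Θ : ℕ → ℝ} (hΘ : ∀ m : ℕ, 1 ≤ m → 0 ≤ Θ m) {n : ℕ}
    (hn : 0 < hNorm Θ n) : IsProbabilityMeasure (weightedMeasure Θ n) := by
  have h := weightedMeasure_real hΘ hn Set.univ
  rw [Set.indicator_univ, sum_permMass hn, measureReal_def] at h
  exact ⟨(ENNReal.toReal_eq_one_iff _).1 h⟩

/-- The law on `ℕ` of the number of cycles. -/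
def natLawTotalCycles (Θ : ℕ → ℝ) (n : ℕ) : Measure ℕ :=
  (weightedMeasure Θ n).map totalCycles

theorem lawTotalCycles_eq_map (Θ : ℕ → ℝ) (n : ℕ) :
    lawTotalCycles Θ n = (natLawTotalCycles Θ n).map fun k : ℕ => (k : ℤ) := by
  rw [natLawTotalCycles, Measure.map_map (by fun_prop) (fun _ _ => MeasurableSpace.measurableSet_top)]
  rfl

theorem natLawTotalCycles_real {Θ : ℕ → ℝ} (hΘ : ∀ m : ℕ, 1 ≤ m → 0 ≤ Θ m) {n : ℕ}
    (hn : 0 < hNorm Θ n) (A : Set ℕ) :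
    (natLawTotalCycles Θ n).real A =
      ∑ σ : Equiv.Perm (Fin n), (totalCycles ⁻¹' A).indicator (permMass Θ) σ := by
  rw [natLawTotalCycles, map_measureReal_apply (fun _ _ => MeasurableSpace.measurableSet_top)
    .of_discrete, weightedMeasure_real hΘ hn]

theorem isProbabilityMeasure_natLawTotalCycles {Θ : ℕ → ℝ} (hΘ : ∀ m : ℕ, 1 ≤ m → 0 ≤ Θ m) {n : ℕ}
    (hn : 0 < hNorm Θ n) : IsProbabilityMeasure (natLawTotalCycles Θ n) := by
  have := isProbabilityMeasure_weightedMeasure hΘ hn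
  exact Measure.isProbabilityMeasure_map
    (Measurable.aemeasurable fun _ _ => MeasurableSpace.measurableSet_top)

theorem totalCycles_le {n : ℕ} (σ : Equiv.Perm (Fin n)) : totalCycles σ ≤ n := by
  calc totalCycles σ ≤ ∑ m ∈ Finset.Icc 1 n, m * cycleCount m σ :=
        Finset.sum_le_sum fun m hm => Nat.le_mul_of_pos_left _ (Finset.mem_Icc.1 hm).1
    _ = n := sum_Icc_mul_cycleCount σ

theorem natLawTotalCycles_real_Iic {Θ : ℕ → ℝ} (hΘ : ∀ m : ℕ, 1 ≤ m → 0 ≤ Θ m) {n : ℕ}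
    (hn : 0 < hNorm Θ n) {k : ℕ} (hk : n ≤ k) : (natLawTotalCycles Θ n).real (Set.Iic k) = 1 := by
  rw [natLawTotalCycles_real hΘ hn]
  have : (totalCycles ⁻¹' Set.Iic k : Set (Equiv.Perm (Fin n))) = Set.univ := by
    ext σ
    simpa using (totalCycles_le σ).trans hk
  rw [this, Set.indicator_univ, sum_permMass hn]

theorem hasSum_natLawTotalCycles {Θ : ℕ → ℝ} (hΘ : ∀ m : ℕ, 1 ≤ m → 0 ≤ Θ m) {n : ℕ}
    (hn : 0 < hNorm Θ n) (w : ℂ) :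
    HasSum (fun k : ℕ => ((natLawTotalCycles Θ n).real {k} : ℂ) * w ^ k)
      (∑ σ : Equiv.Perm (Fin n), (permMass Θ σ : ℂ) * w ^ totalCycles σ) := by
  classical
  have h1 : (fun k : ℕ => ((natLawTotalCycles Θ n).real {k} : ℂ) * w ^ k) =
      fun k => ∑ σ : Equiv.Perm (Fin n),
        if k = totalCycles σ then (permMass Θ σ : ℂ) * w ^ totalCycles σ else 0 := by
    ext k
    rw [natLawTotalCycles_real hΘ hn]
    push_cast
    rw [Finset.sum_mul]
    refine Finset.sum_congr rfl fun σ _ => ?_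
    by_cases h : k = totalCycles σ
    · simp [h]
    · simp [h, Ne.symm h]
  rw [h1]
  exact hasSum_sum fun σ _ => hasSum_ite_eq _ _

theorem charSum_natLawTotalCycles {Θ : ℕ → ℝ} (hΘ : ∀ m : ℕ, 1 ≤ m → 0 ≤ Θ m) {n : ℕ}
    (hn : 0 < hNorm Θ n) (s : ℝ) :
    charSum (fun k => (natLawTotalCycles Θ n).real {k}) s =
      ((1 / (n ! : ℂ)) * ∑ σ : Equiv.Perm (Fin n),
        Complex.exp ((s : ℂ) * Complex.I) ^ totalCycles σ * (cycleWeight Θ σ : ℂ)) /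
        (hNorm Θ n : ℂ) := by
  have h := (hasSum_natLawTotalCycles hΘ hn (Complex.exp ((s : ℂ) * Complex.I))).tsum_eq
  have e : ∀ k : ℕ, Complex.exp ((s : ℂ) * Complex.I) ^ k =
      Complex.exp (((k * s : ℝ) : ℂ) * Complex.I) := by
    intro k
    rw [← Complex.exp_nat_mul]
    congr 1
    push_cast
    ring
  have h1 : charSum (fun k => (natLawTotalCycles Θ n).real {k}) s =
      ∑' k : ℕ, ((natLawTotalCycles Θ n).real {k} : ℂ) * Complex.exp ((s : ℂ) * Complex.I) ^ k := by
    rw [charSum]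
    simp_rw [e]
  rw [h1, h, Finset.mul_sum, Finset.sum_div]
  refine Finset.sum_congr rfl fun σ _ => ?_
  unfold permMass
  push_cast
  ring

theorem charSum_poissonMeasure {lam : ℝ} (hl : 0 ≤ lam) (s : ℝ) :
    charSum (fun k => (poissonMeasure lam.toNNReal).real {k}) s =
      Complex.exp ((Complex.exp ((s : ℂ) * Complex.I) - 1) * lam) := by
  set w := Complex.exp ((s : ℂ) * Complex.I) with hw
  have h1 := NormedSpace.expSeries_div_hasSum_exp ((lam : ℂ) * w)
  rw [← Complex.exp_eq_exp_ℂ] at h1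
  have h2 := h1.mul_left (Complex.exp (-lam))
  rw [← Complex.exp_add] at h2
  have h3 : charSum (fun k => (poissonMeasure lam.toNNReal).real {k}) s =
      ∑' k : ℕ, Complex.exp (-lam) * (((lam : ℂ) * w) ^ k / (k ! : ℂ)) := by
    rw [charSum]
    refine tsum_congr fun k => ?_
    rw [poissonMeasure_real_singleton, Real.coe_toNNReal _ hl, mul_pow, hw, ← Complex.exp_nat_mul]
    push_cast
    rw [show (k : ℂ) * (s : ℂ) * Complex.I = k * ((s : ℂ) * Complex.I) by ring]
    ring
  rw [h3, h2.tsum_eq]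
  congr 1
  ring

theorem charSum_sub {d e : ℕ → ℝ} (hd : Summable d) (he : Summable e) (s : ℝ) :
    charSum (fun k => d k - e k) s = charSum d s - charSum e s := by
  rw [← ((hasSum_charSum hd s).sub (hasSum_charSum he s)).tsum_eq, charSum]
  refine tsum_congr fun k => ?_
  push_cast
  ring

theorem norm_exp_mul_I_sub_one_le (s : ℝ) : ‖Complex.exp ((s : ℂ) * Complex.I) - 1‖ ≤ |s| := by
  rw [mul_comm]
  simpa using Real.norm_exp_I_mul_ofReal_sub_one_le (x := s)

/-- The modulus is `exp((cos s - 1) lam)`, and `cos s ≤ 1 - 2s²/π²` on `[-π, π]`. -/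
theorem norm_exp_charPoisson_le {lam s : ℝ} (hl : 0 ≤ lam) (hs : |s| ≤ Real.pi) :
    ‖Complex.exp ((Complex.exp ((s : ℂ) * Complex.I) - 1) * lam)‖ ≤
      Real.exp (-(2 / Real.pi ^ 2 * lam) * s ^ 2) := by
  rw [Complex.norm_exp]
  refine Real.exp_le_exp.2 ?_
  have h1 : ((Complex.exp ((s : ℂ) * Complex.I) - 1) * lam).re = (Real.cos s - 1) * lam := by
    rw [Complex.re_mul_ofReal, Complex.sub_re, Complex.exp_ofReal_mul_I_re, Complex.one_re]
  rw [h1]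
  have := Real.cos_le_one_sub_mul_cos_sq hs
  calc _ ≤ (-(2 / Real.pi ^ 2 * s ^ 2)) * lam := by gcongr; linarith
    _ = _ := by ring

/-! ### Comparison of the number of cycles with a Poisson variable -/

/-- The difference of the point probabilities of `K_{0n}` and of a Poisson variable. -/
def pointDiff (Θ : ℕ → ℝ) (n : ℕ) (lam : ℝ) (k : ℕ) : ℝ :=
  (natLawTotalCycles Θ n).real {k} - (poissonMeasure lam.toNNReal).real {k}

/-- After rescaling by `r`, `Θ k / k` is `θ / k` plus a summable sequence `β = O(k ^ (-s))` with
sum `K`. -/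
structure IsLogPerturbation (Θ : ℕ → ℝ) (r θ K s : ℝ) : Prop where
  r_pos : 0 < r
  one_lt : 1 < s
  le_two : s ≤ 2
  exists_bound : ∃ B : ℝ, ∀ k : ℕ,
    |Θ k * r ^ k / k - θ / k| ≤ B * ((k : ℝ) + 1) ^ (-s)
  hasSum : HasSum (fun k : ℕ => Θ k * r ^ k / k - θ / k) K

theorem IsLogPerturbation.exists_coeff_eq {Θ : ℕ → ℝ} {r θ K s : ℝ} (hθ : 0 < θ)
    (h : IsLogPerturbation Θ r θ K s) :
    ∃ C M : ℝ, 0 ≤ C ∧ 0 ≤ M ∧ ∀ n : ℕ, 1 ≤ n → ∃ N : ℝ, 0 < N ∧ ∀ w : ℂ, ‖w‖ ≤ 1 →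
      ∃ Ψ e : ℂ, ‖Ψ - 1‖ ≤ C * ‖w - 1‖ ∧ ‖e‖ ≤ M * (n : ℝ) ^ (-((s - 1) / 2)) ∧
      (1 / (n ! : ℂ)) * ∑ σ : Equiv.Perm (Fin n), w ^ totalCycles σ * (cycleWeight Θ σ : ℂ) =
        N * (Ψ * Complex.exp ((w - 1) * (K + θ * Real.log n : ℝ)) + e) := by
  obtain ⟨B, hB⟩ := h.exists_bound
  obtain ⟨M, hM, hM'⟩ := exists_norm_coeff_expSeries_sub_le h.one_lt h.le_two hθ
    (β := fun k : ℕ => Θ k * r ^ k / k - θ / k) (by simp) hB h.hasSum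
  obtain ⟨C, hC, hC'⟩ := exists_risingCoeff_eq_mul_exp hθ
  refine ⟨C, M * Real.exp (-K), hC, by positivity, fun n hn => ?_⟩
  have hr := h.r_pos
  have hA := risingCoeff_pos hθ n
  have hrn : ((r : ℂ) ^ n) ≠ 0 := pow_ne_zero _ (by exact_mod_cast hr.ne')
  have hAc : ((risingCoeff θ n : ℝ) : ℂ) ≠ 0 := by exact_mod_cast hA.ne'
  -- `N` is the leading term of `h_n`, that is, of the left side at `w = 1`.
  refine ⟨risingCoeff θ n * Real.exp K / r ^ n, by positivity, fun w hw => ?_⟩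
  obtain ⟨Ψ, hΨ, hΨ'⟩ := hC' w hw n hn
  have hP := isExpSeries_sum_perm Θ r w
  have hP' := hM' w hw _ (by simpa only [add_sub_cancel] using hP) n hn
  rw [PowerSeries.coeff_mk] at hP'
  set S := (1 / (n ! : ℂ)) * ∑ σ : Equiv.Perm (Fin n), w ^ totalCycles σ * (cycleWeight Θ σ : ℂ)
  refine ⟨Ψ, ((r : ℂ) ^ n * S - Complex.exp (w * K) * risingCoeff (w * θ) n) /
    ((risingCoeff θ n * Real.exp K : ℝ) : ℂ), hΨ, ?_, ?_⟩
  · rw [norm_div, Complex.norm_real, Real.norm_eq_abs, abs_of_pos (by positivity),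
      div_le_iff₀ (by positivity)]
    refine hP'.trans_eq ?_
    have : Real.exp (-K) * Real.exp K = 1 := by rw [← Real.exp_add]; simp
    linear_combination (-(M * (n : ℝ) ^ (-((s - 1) / 2)) * risingCoeff θ n)) * this
  · have he : Complex.exp (w * K) = Complex.exp K * Complex.exp ((w - 1) * K) := by
      rw [← Complex.exp_add]; congr 1; ring
    have he2 : Complex.exp ((w - 1) * (K + θ * Real.log n : ℝ)) =
        Complex.exp ((w - 1) * K) * Complex.exp ((w - 1) * (θ * Real.log n : ℝ)) := by
      rw [← Complex.exp_add]; congr 1; push_cast; ring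
    have hK : Complex.exp K ≠ 0 := Complex.exp_ne_zero _
    rw [hΨ', he, he2]
    push_cast
    field_simp
    ring

theorem IsLogPerturbation.exists_norm_charSum_pointDiff_le {Θ : ℕ → ℝ}
    (hΘ : ∀ m : ℕ, 1 ≤ m → 0 ≤ Θ m) {r θ K s : ℝ} (hθ : 0 < θ)
    (h : IsLogPerturbation Θ r θ K s) :
    ∃ C M : ℝ, 0 ≤ C ∧ 0 ≤ M ∧ ∀ᶠ n : ℕ in atTop, 0 < hNorm Θ n ∧
      θ / 2 * Real.log n ≤ K + θ * Real.log n ∧ ∀ t : ℝ, |t| ≤ Real.pi →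
      ‖charSum (pointDiff Θ n (K + θ * Real.log n)) t‖ ≤
        C * (|t| * Real.exp (-(2 / Real.pi ^ 2 * (K + θ * Real.log n)) * t ^ 2)) +
          M * (n : ℝ) ^ (-((s - 1) / 2)) := by
  obtain ⟨C, M, hC, hM, hmain⟩ := h.exists_coeff_eq hθ
  refine ⟨2 * C, 4 * M, by positivity, by positivity, ?_⟩
  have hδ : 0 < (s - 1) / 2 := by have := h.one_lt; linarith
  have hlim : Tendsto (fun n : ℕ => M * (n : ℝ) ^ (-((s - 1) / 2))) atTop (𝓝 0) := by
    have := ((tendsto_rpow_neg_atTop hδ).comp tendsto_natCast_atTop_atTop).const_mul M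
    simpa using this
  have hlog : Tendsto (fun n : ℕ => θ / 2 * Real.log n) atTop atTop :=
    (Real.tendsto_log_atTop.comp tendsto_natCast_atTop_atTop).const_mul_atTop (by positivity)
  filter_upwards [hlim.eventually_lt_const (by norm_num : (0 : ℝ) < 1 / 2),
    hlog.eventually_ge_atTop (-K), eventually_ge_atTop 1] with n hn1 hn2 hn
  obtain ⟨N, hN, hw⟩ := hmain n hn
  set lam := K + θ * Real.log n with hlam
  have hlogn : 0 ≤ Real.log n := Real.log_nonneg (by exact_mod_cast hn)
  have hlam0 : 0 ≤ lam := by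
    rw [hlam]
    nlinarith [mul_nonneg hθ.le hlogn]
  obtain ⟨Ψ₁, e₁, hΨ₁, he₁, heq₁⟩ := hw 1 (by simp)
  -- At `w = 1` the bound `C * ‖w - 1‖` vanishes, so `h_n = N (1 + e₁)` exactly. With `‖e₁‖ ≤ 1/2`
  -- this gives positivity, and dividing by `1 + e₁` costs the factor 2 in the constants.
  have hΨ₁' : Ψ₁ = 1 := by
    rw [← sub_eq_zero, ← norm_le_zero_iff]
    simpa using hΨ₁
  have heq₁' : ((hNorm Θ n : ℝ) : ℂ) = N * (1 + e₁) := by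
    rw [hΨ₁'] at heq₁
    simp only [one_pow, one_mul, sub_self, zero_mul, Complex.exp_zero, mul_one] at heq₁
    rw [← heq₁, hNorm]
    push_cast
    rfl
  have he₁h : ‖e₁‖ ≤ 1 / 2 := he₁.trans hn1.le
  have hnorm1 : 1 / 2 ≤ ‖1 + e₁‖ := by
    have := norm_sub_norm_le (1 : ℂ) (-e₁)
    rw [sub_neg_eq_add, norm_neg, norm_one] at this
    linarith
  have hpos : 0 < hNorm Θ n := by
    have h1 : hNorm Θ n = N * (1 + e₁.re) := by
      have := congrArg Complex.re heq₁'
      simpa using this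
    have h2 := (Complex.abs_re_le_norm e₁).trans he₁h
    rw [h1]
    have := (abs_le.1 h2).1
    exact mul_pos hN (by linarith)
  refine ⟨hpos, by rw [hlam]; linarith, fun t ht => ?_⟩
  have := isProbabilityMeasure_natLawTotalCycles hΘ hpos
  have hsub := charSum_sub (summable_real_singleton (natLawTotalCycles Θ n))
    (summable_real_singleton (poissonMeasure lam.toNNReal)) t
  rw [charSum_natLawTotalCycles hΘ hpos, charSum_poissonMeasure hlam0] at hsub
  have hwn : ‖Complex.exp ((t : ℂ) * Complex.I)‖ ≤ 1 := (Complex.norm_exp_ofReal_mul_I t).le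
  obtain ⟨Ψ, e, hΨ, he, heq⟩ := hw _ hwn
  rw [heq, heq₁'] at hsub
  have hz := norm_exp_charPoisson_le hlam0 ht
  have hz1 : ‖Complex.exp ((Complex.exp ((t : ℂ) * Complex.I) - 1) * lam)‖ ≤ 1 := by
    refine hz.trans (Real.exp_le_one_iff.2 ?_)
    have : 0 ≤ 2 / Real.pi ^ 2 * lam * t ^ 2 := by positivity
    linarith
  set z := Complex.exp ((Complex.exp ((t : ℂ) * Complex.I) - 1) * lam) with hzdef
  set E := M * (n : ℝ) ^ (-((s - 1) / 2)) with hE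
  have hE0 : 0 ≤ E := by positivity
  have hNc : (N : ℂ) ≠ 0 := by exact_mod_cast hN.ne'
  have h1e : 1 + e₁ ≠ 0 := by
    intro h0
    rw [h0, norm_zero] at hnorm1
    linarith
  have hdiff : charSum (pointDiff Θ n lam) t = ((Ψ - 1) * z + e - e₁ * z) / (1 + e₁) := by
    unfold pointDiff
    rw [hsub]
    field_simp
    ring
  rw [hdiff, norm_div, div_le_iff₀ (by linarith)]
  have hΨt : ‖Ψ - 1‖ ≤ C * |t| := hΨ.trans (by gcongr; exact norm_exp_mul_I_sub_one_le t)
  have hnum : ‖(Ψ - 1) * z + e - e₁ * z‖ ≤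
      C * |t| * Real.exp (-(2 / Real.pi ^ 2 * lam) * t ^ 2) + E + E := by
    refine (norm_sub_le _ _).trans (add_le_add ((norm_add_le _ _).trans (add_le_add ?_ he)) ?_)
    · rw [norm_mul]
      gcongr
    · rw [norm_mul]
      calc _ ≤ E * 1 := by gcongr
        _ = E := mul_one _
  refine hnum.trans ?_
  have hp : 0 ≤ C * (|t| * Real.exp (-(2 / Real.pi ^ 2 * lam) * t ^ 2)) := by positivity
  nlinarith

theorem IsLogPerturbation.exists_bounds {Θ : ℕ → ℝ}
    (hΘ : ∀ m : ℕ, 1 ≤ m → 0 ≤ Θ m) {r θ K s : ℝ} (hθ : 0 < θ)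
    (h : IsLogPerturbation Θ r θ K s) :
    ∃ c₁ c₂ : ℝ, 0 ≤ c₁ ∧ 0 ≤ c₂ ∧ ∀ᶠ n : ℕ in atTop,
      (0 < hNorm Θ n ∧ 0 < K + θ * Real.log n) ∧
      dLoc (lawTotalCycles Θ n) (poissonLaw (K + θ * Real.log n)) ≤ c₁ / Real.log n ∧
      dKol (lawTotalCycles Θ n) (poissonLaw (K + θ * Real.log n)) ≤ c₂ / √(Real.log n) := by
  obtain ⟨C, M, hC, hM, hev⟩ := h.exists_norm_charSum_pointDiff_le hΘ hθ
  set δ := (s - 1) / 2 with hδ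
  have hδ0 : 0 < δ := by have := h.one_lt; rw [hδ]; linarith
  have hδ1 : δ ≤ 1 := by have := h.le_two; rw [hδ]; linarith
  have hpi := Real.pi_pos
  refine ⟨C * Real.pi ^ 2 / θ + M / δ, C * √(Real.pi ^ 3 / θ) +
    M * (2 ^ (δ / 2) * (Real.pi / (δ / 2))) / (δ / 2), by positivity, by positivity, ?_⟩
  have hlog1 : ∀ᶠ n : ℕ in atTop, 1 ≤ Real.log n :=
    (Real.tendsto_log_atTop.comp tendsto_natCast_atTop_atTop).eventually_ge_atTop 1
  filter_upwards [hev, hlog1, eventually_ge_atTop 2] with n ⟨hn1, hn2, hn3⟩ hL hn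
  set L := Real.log n with hLdef
  set lam := K + θ * L with hlam
  have hL0 : 0 < L := by linarith
  have hn0 : (0 : ℝ) < n := by exact_mod_cast (by omega : 0 < n)
  have hlam0 : 0 < lam := lt_of_lt_of_le (by positivity) hn2
  have := isProbabilityMeasure_natLawTotalCycles hΘ hn1
  set b := 2 / Real.pi ^ 2 * lam with hb
  have hb0 : 0 < b := by positivity
  -- For large `n` the parameter `lam` is at least `θ L / 2`, so bounds in terms of `lam` become
  -- bounds in terms of `log n`.
  have hbL : θ * L / Real.pi ^ 2 ≤ b := by
    rw [hb, div_mul_eq_mul_div]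
    refine div_le_div_of_nonneg_right ?_ (by positivity)
    linarith
  have hd : Summable (pointDiff Θ n lam) := (summable_real_singleton _).sub (summable_real_singleton _)
  have hpowlog : ∀ ε : ℝ, 0 < ε → (n : ℝ) ^ (-ε) ≤ 1 / ε / L := by
    intro ε hε
    have h1 := Real.log_le_rpow_div hn0.le hε
    rw [Real.rpow_neg hn0.le, div_div, ← one_div]
    refine one_div_le_one_div_of_le (by positivity) ?_
    rw [le_div_iff₀ hε] at h1
    linarith
  refine ⟨⟨hn1, hlam0⟩, ?_, ?_⟩
  · rw [lawTotalCycles_eq_map, poissonLaw]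
    refine dLoc_map_natCast_le fun k => ?_
    refine (abs_le_of_norm_charSum_le hd hC hb0 hn3 k).trans ?_
    have h1 : C / b ≤ C * Real.pi ^ 2 / θ / L := by
      calc C / b ≤ C / (θ * L / Real.pi ^ 2) := by gcongr
        _ = _ := by field_simp
    have h2 : M * (n : ℝ) ^ (-δ) ≤ M / δ / L := by
      calc _ ≤ M * (1 / δ / L) := by gcongr; exact hpowlog δ hδ0
        _ = _ := by ring
    rw [add_div]
    exact add_le_add h1 h2
  · have hsq : √L ≤ L := by
      rw [Real.sqrt_le_left hL0.le]
      nlinarith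
    have hsqp : 0 < √L := Real.sqrt_pos.2 hL0
    have key : ∀ k : ℕ, k ≤ n → |(natLawTotalCycles Θ n).real (Set.Iic k) -
        (poissonMeasure lam.toNNReal).real (Set.Iic k)| ≤ (C * √(Real.pi ^ 3 / θ) +
          M * (2 ^ (δ / 2) * (Real.pi / (δ / 2))) / (δ / 2)) / √L := by
      intro k hk
      rw [real_Iic_eq_sum, real_Iic_eq_sum, ← Finset.sum_sub_distrib]
      -- With this `p` the power of `k + 1 ≤ 2n` lost is `n^(δ/2)`, half of the gain `n^(-δ)`.
      refine (abs_sum_le_of_norm_charSum_le (p := 1 - δ / 2) hd hC hb0 (by positivity)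
        (by linarith) (by linarith) hn3 (k + 1)).trans ?_
      rw [sub_sub_cancel, add_div]
      refine add_le_add ?_ ?_
      · rw [mul_div_assoc]
        gcongr
        rw [← Real.sqrt_div (by positivity)]
        refine Real.sqrt_le_sqrt ?_
        calc Real.pi / b ≤ Real.pi / (θ * L / Real.pi ^ 2) := by gcongr
          _ = _ := by field_simp
      · have hk2 : ((k + 1 : ℕ) : ℝ) ≤ 2 * n := by
          exact_mod_cast (by omega : k + 1 ≤ 2 * n)
        have hnn : (n : ℝ) ^ (-δ) * (n : ℝ) ^ (δ / 2) = (n : ℝ) ^ (-(δ / 2)) := by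
          rw [← Real.rpow_add hn0]
          congr 1
          ring
        calc M * (n : ℝ) ^ (-δ) * (((k + 1 : ℕ) : ℝ) ^ (δ / 2) * (Real.pi / (δ / 2)))
            ≤ M * (n : ℝ) ^ (-δ) * ((2 * n) ^ (δ / 2) * (Real.pi / (δ / 2))) := by gcongr
          _ = M * (2 ^ (δ / 2) * (Real.pi / (δ / 2))) * (n : ℝ) ^ (-(δ / 2)) := by
              rw [Real.mul_rpow (by norm_num) hn0.le, ← hnn]; ring
          _ ≤ M * (2 ^ (δ / 2) * (Real.pi / (δ / 2))) * (1 / (δ / 2) / √L) := by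
              gcongr
              refine (hpowlog _ (by positivity)).trans ?_
              gcongr
          _ = _ := by ring
    rw [lawTotalCycles_eq_map, poissonLaw]
    refine dKol_map_natCast_le fun k => ?_
    rcases le_total k n with hk | hk
    · exact key k hk
    -- Since `K_{0n} ≤ n`, its distribution function is 1 from `n` on, and the difference is the
    -- Poisson tail, which decreases in `k`.
    · refine le_trans ?_ (key n le_rfl)
      rw [natLawTotalCycles_real_Iic hΘ hn1 hk, natLawTotalCycles_real_Iic hΘ hn1 le_rfl]
      have h1 : (poissonMeasure lam.toNNReal).real (Set.Iic k) ≤ 1 := measureReal_le_one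
      have h2 : (poissonMeasure lam.toNNReal).real (Set.Iic n) ≤
          (poissonMeasure lam.toNNReal).real (Set.Iic k) :=
        measureReal_mono (Set.Iic_subset_Iic.2 hk)
      rw [abs_of_nonneg (by linarith), abs_of_nonneg (by linarith)]
      linarith

/-! ### From large `n` to all `n ≥ 2`. -/

theorem isProbabilityMeasure_lawTotalCycles {Θ : ℕ → ℝ} (hΘ : ∀ m : ℕ, 1 ≤ m → 0 ≤ Θ m) {n : ℕ}
    (hn : 0 < hNorm Θ n) : IsProbabilityMeasure (lawTotalCycles Θ n) := by
  have := isProbabilityMeasure_weightedMeasure hΘ hn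
  exact Measure.isProbabilityMeasure_map
    (Measurable.aemeasurable fun _ _ => MeasurableSpace.measurableSet_top)

instance isProbabilityMeasure_poissonLaw (lam : ℝ) : IsProbabilityMeasure (poissonLaw lam) :=
  Measure.isProbabilityMeasure_map (by fun_prop)

/-- An eventual bound `c / f n` for a quantity at most `1` extends to all `n` with `0 < f n`,
for monotone `f`. -/
theorem exists_forall_le_div_of_eventually {d f : ℕ → ℝ} {p : ℕ → Prop} {c : ℝ} (hc : 0 ≤ c)
    (hd : ∀ n, p n → d n ≤ 1) (hf : ∀ n, 2 ≤ n → 0 < f n)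
    (hmono : ∀ m n, 2 ≤ m → m ≤ n → f m ≤ f n)
    (hev : ∀ᶠ n in atTop, d n ≤ c / f n) :
    ∃ c' : ℝ, 0 < c' ∧ ∀ n, 2 ≤ n → p n → d n ≤ c' / f n := by
  obtain ⟨n₀, hn₀⟩ := eventually_atTop.1 hev
  have hpos := hf (max n₀ 2) (le_max_right _ _)
  -- For `n ≤ n₀` monotonicity gives `f n ≤ f (max n₀ 2)`, so the new right side is at least 1.
  refine ⟨c + f (max n₀ 2), by linarith, fun n hn hp => ?_⟩
  have hfn := hf n hn
  rcases le_total n₀ n with h | h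
  · refine (hn₀ n h).trans ?_
    gcongr
    linarith
  · refine (hd n hp).trans ?_
    rw [le_div_iff₀ hfn]
    have := hmono n _ hn (h.trans (le_max_left n₀ 2))
    linarith

theorem IsLogPerturbation.main {Θ : ℕ → ℝ}
    (hΘ : ∀ m : ℕ, 1 ≤ m → 0 ≤ Θ m) {r θ K s : ℝ} (hθ : 0 < θ)
    (h : IsLogPerturbation Θ r θ K s) :
    (∀ᶠ n : ℕ in atTop, 0 < hNorm Θ n ∧ 0 < K + θ * Real.log n) ∧
    (∃ c₁ : ℝ, 0 < c₁ ∧ ∀ n : ℕ, 2 ≤ n → 0 < hNorm Θ n → 0 ≤ K + θ * Real.log n →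
      dLoc (lawTotalCycles Θ n) (poissonLaw (K + θ * Real.log n)) ≤ c₁ / Real.log n) ∧
    (∃ c₂ : ℝ, 0 < c₂ ∧ ∀ n : ℕ, 2 ≤ n → 0 < hNorm Θ n → 0 ≤ K + θ * Real.log n →
      dKol (lawTotalCycles Θ n) (poissonLaw (K + θ * Real.log n))
        ≤ c₂ / Real.sqrt (Real.log n)) := by
  obtain ⟨c₁, c₂, hc₁, hc₂, hev⟩ := h.exists_bounds hΘ hθ
  have hlogpos : ∀ n : ℕ, 2 ≤ n → 0 < Real.log n := fun n hn =>
    Real.log_pos (by exact_mod_cast (by omega : 1 < n))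
  have hlogmono : ∀ m n : ℕ, 2 ≤ m → m ≤ n → Real.log m ≤ Real.log n := fun m n hm hmn =>
    Real.log_le_log (by exact_mod_cast (by omega : 0 < m)) (by exact_mod_cast hmn)
  refine ⟨hev.mono fun n hn => hn.1, ?_, ?_⟩
  · obtain ⟨c, hc, hcb⟩ := exists_forall_le_div_of_eventually
      (d := fun n => dLoc (lawTotalCycles Θ n) (poissonLaw (K + θ * Real.log n)))
      (f := fun n => Real.log n) (p := fun n => 0 < hNorm Θ n) hc₁
      (fun n hn => by
        have := isProbabilityMeasure_lawTotalCycles hΘ hn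
        exact ciSup_le fun j => abs_real_sub_real_le_one _ _ _)
      hlogpos hlogmono (hev.mono fun n hn => hn.2.1)
    exact ⟨c, hc, fun n hn hp _ => hcb n hn hp⟩
  · obtain ⟨c, hc, hcb⟩ := exists_forall_le_div_of_eventually
      (d := fun n => dKol (lawTotalCycles Θ n) (poissonLaw (K + θ * Real.log n)))
      (f := fun n => √(Real.log n)) (p := fun n => 0 < hNorm Θ n) hc₂
      (fun n hn => by
        have := isProbabilityMeasure_lawTotalCycles hΘ hn
        exact ciSup_le fun j => abs_real_sub_real_le_one _ _ _)
      (fun n hn => Real.sqrt_pos.2 (hlogpos n hn))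
      (fun m n hm hmn => Real.sqrt_le_sqrt (hlogmono m n hm hmn))
      (hev.mono fun n hn => hn.2.2)
    exact ⟨c, hc, fun n hn hp _ => hcb n hn hp⟩

/-! ### Taylor coefficients and the logarithmic singularity -/

/-- The cut of the logarithm corresponds to the ray `t ≥ r`, which is exactly where the real part of
`t - r` equals its modulus. -/
theorem one_sub_div_mem_slitPlane {r : ℝ} (hr : 0 < r) {t : ℂ}
    (h : (t - r).re < ‖t - r‖) : 1 - t / r ∈ Complex.slitPlane := by
  rw [Complex.mem_slitPlane_iff]
  by_contra hcon
  push Not at hcon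
  obtain ⟨h1, h2⟩ := hcon
  rw [Complex.sub_re, Complex.one_re, Complex.div_ofReal_re] at h1
  rw [Complex.sub_im, Complex.one_im, Complex.div_ofReal_im, zero_sub, neg_eq_zero,
    div_eq_zero_iff] at h2
  have h3 : t.im = 0 := h2.resolve_right hr.ne'
  have h4 : r ≤ t.re := by
    have : 1 ≤ t.re / r := by linarith
    rwa [le_div_iff₀ hr, one_mul] at this
  have h5 : t - r = ((t.re - r : ℝ) : ℂ) := by
    apply Complex.ext <;> simp [h3]
  rw [h5, Complex.norm_real, Complex.ofReal_re, Real.norm_eq_abs, abs_of_nonneg (by linarith)] at h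
  exact lt_irrefl _ h

theorem re_sub_neg_of_mem_closedBall {r : ℝ} {t : ℂ} (ht : ‖t‖ ≤ r) (hne : t ≠ r) :
    (t - r).re < 0 := by
  have h1 := Complex.re_le_norm t
  rw [Complex.sub_re, Complex.ofReal_re]
  rcases (h1.trans ht).eq_or_lt with h | h
  · exfalso
    have h2 : t.re = ‖t‖ := le_antisymm h1 (by linarith)
    have h3 : t.im = 0 := by
      have := Complex.sq_norm t
      rw [Complex.normSq_apply, ← h2] at this
      nlinarith
    exact hne (Complex.ext (by simp [h]) (by simp [h3]))
  · linarith

theorem ne_ofReal_of_mem_ball {r : ℝ} {t : ℂ} (ht : t ∈ Metric.ball (0 : ℂ) r) : t ≠ r := by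
  rintro rfl
  rw [mem_ball_zero_iff, Complex.norm_real, Real.norm_eq_abs] at ht
  exact absurd ht (not_lt.2 (le_abs_self r))

theorem log_one_div_one_sub_div {t : ℂ} {r : ℝ} (h : 1 - t / r ∈ Complex.slitPlane) :
    Complex.log (1 / (1 - t / r)) = -Complex.log (1 - t / r) := by
  rw [one_div, Complex.log_inv _ (Complex.slitPlane_arg_ne_pi h)]

theorem hasFPowerSeriesAt_ofScalars_iff {f : ℂ → ℂ} {c : ℕ → ℂ} :
    HasFPowerSeriesAt f (FormalMultilinearSeries.ofScalars ℂ c) 0 ↔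
      ∀ᶠ z : ℂ in 𝓝 0, HasSum (fun n => z ^ n * c n) (f z) := by
  rw [hasFPowerSeriesAt_iff]
  simp [FormalMultilinearSeries.coeff_ofScalars]

theorem eventually_hasSum_neg_log {r : ℝ} (hr : 0 < r) :
    ∀ᶠ z : ℂ in 𝓝 0, HasSum (fun n : ℕ => z ^ n * (1 / (n * (r : ℂ) ^ n)))
      (-Complex.log (1 - z / r)) := by
  filter_upwards [Metric.ball_mem_nhds (0 : ℂ) hr] with z hz
  have h : ‖z / (r : ℂ)‖ < 1 := by
    rw [norm_div, Complex.norm_real, Real.norm_eq_abs, abs_of_pos hr, div_lt_one hr]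
    simpa using hz
  have := Complex.hasSum_taylorSeries_neg_log h
  convert this using 2 with n
  rw [div_pow]
  ring

/-- The Taylor coefficients of `g + θ log (1 - t / r) - K`. -/
theorem hasFPowerSeriesAt_add_log {Θ : ℕ → ℝ} {g : ℂ → ℂ} (hg : HasFPowerSeriesAt g (gSeries Θ) 0)
    {r θ : ℝ} (hr : 0 < r) (K : ℂ) :
    HasFPowerSeriesAt (fun t : ℂ => g t + θ * Complex.log (1 - t / r) - K)
      (FormalMultilinearSeries.ofScalars ℂ fun k : ℕ =>
        ((Θ k / k - θ / (k * r ^ k) : ℝ) : ℂ) - if k = 0 then K else 0) 0 := by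
  rw [gSeries] at hg
  rw [hasFPowerSeriesAt_ofScalars_iff] at hg ⊢
  filter_upwards [hg, eventually_hasSum_neg_log hr] with z h1 h2
  have h3 : HasSum (fun n : ℕ => if n = 0 then K else 0) K := hasSum_ite_eq 0 K
  have h4 := (h1.sub (h2.mul_left (θ : ℂ))).sub h3
  have e1 : g z - θ * -Complex.log (1 - z / r) - K = g z + θ * Complex.log (1 - z / r) - K := by
    ring
  rw [e1] at h4
  refine h4.congr_fun fun n => ?_
  rcases eq_or_ne n 0 with rfl | hn
  · simp
  · simp only [if_neg hn, sub_zero]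
    push_cast
    ring

theorem coeff_eq_of_hasFPowerSeriesAt {f : ℂ → ℂ} {c c' : ℕ → ℂ}
    (h : HasFPowerSeriesAt f (FormalMultilinearSeries.ofScalars ℂ c) 0)
    (h' : HasFPowerSeriesAt f (FormalMultilinearSeries.ofScalars ℂ c') 0) : c = c' :=
  FormalMultilinearSeries.ofScalars_series_injective ℂ ℂ (h.eq_formalMultilinearSeries h')

theorem iteratedDeriv_eq_factorial_mul {f : ℂ → ℂ} {c : ℕ → ℂ}
    (h : HasFPowerSeriesAt f (FormalMultilinearSeries.ofScalars ℂ c) 0) (n : ℕ) :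
    iteratedDeriv n f 0 = n ! * c n := by
  obtain ⟨R, hR⟩ := h
  rw [iteratedDeriv_eq_iteratedFDeriv, ← hR.factorial_smul 1 n, nsmul_eq_mul]
  congr 1
  rw [FormalMultilinearSeries.ofScalars_apply_eq]
  simp

/-- Shifting to `n + 1` makes the comparison sequence nonzero everywhere, including at `n = 0`, so
the eventual bound holds for all `n` after enlarging the constant. -/
theorem exists_forall_le_of_isBigO {s : ℝ} (hs : 0 ≤ s) {f : ℕ → ℝ}
    (h : f =O[atTop] fun n : ℕ => (n : ℝ) ^ (-s)) :
    ∃ B : ℝ, ∀ n : ℕ, |f n| ≤ B * ((n : ℝ) + 1) ^ (-s) := by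
  have h1 : (fun n : ℕ => (n : ℝ) ^ (-s)) =O[atTop] fun n : ℕ => ((n : ℝ) + 1) ^ (-s) := by
    refine IsBigO.of_bound (2 ^ s) ?_
    filter_upwards [eventually_ge_atTop 1] with n hn
    have hn' : (1 : ℝ) ≤ n := by exact_mod_cast hn
    rw [Real.norm_of_nonneg (by positivity), Real.norm_of_nonneg (by positivity)]
    have h2 : ((n : ℝ) + 1) / n ≤ 2 := by
      rw [div_le_iff₀ (by linarith)]; linarith
    have h4 : (((n : ℝ) + 1) / n) ^ s ≤ 2 ^ s := by gcongr
    rw [Real.div_rpow (by positivity) (by positivity), div_le_iff₀ (by positivity)] at h4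
    rw [Real.rpow_neg (by positivity), Real.rpow_neg (by positivity), ← div_eq_mul_inv,
      le_div_iff₀ (by positivity), inv_mul_le_iff₀ (by positivity)]
    linarith
  obtain ⟨B, hB⟩ := (isBigO_nat_atTop_iff (fun n hn => by
    have : (0 : ℝ) < ((n : ℝ) + 1) ^ (-s) := by positivity
    exact absurd hn this.ne')).1 (h.trans h1)
  refine ⟨B, fun n => ?_⟩
  have := hB n
  rwa [Real.norm_eq_abs, Real.norm_eq_abs, abs_of_pos (by positivity : (0:ℝ) < ((n : ℝ) + 1) ^ (-s))]
    at this

/-! ### The class `eF` -/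

theorem IsClassEF.isLogPerturbation {Θ : ℕ → ℝ} {g : ℂ → ℂ}
    (hg : HasFPowerSeriesAt g (gSeries Θ) 0) {r θ K γ : ℝ} (h : IsClassEF g r θ γ (K : ℂ)) :
    IsLogPerturbation Θ r θ K (1 + γ) := by
  obtain ⟨hr, -, hγ, hγ1, hd, g₀, b, hg₀, heq, hb, hsum⟩ := h
  set f : ℂ → ℂ := fun t => g t + θ * Complex.log (1 - t / r) - 0 with hf
  have hslit : ∀ t ∈ Metric.ball (0 : ℂ) r, 1 - t / r ∈ Complex.slitPlane := by
    intro t ht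
    refine one_sub_div_mem_slitPlane hr ?_
    exact (re_sub_neg_of_mem_closedBall (mem_ball_zero_iff.1 ht).le
      (ne_ofReal_of_mem_ball ht)).trans_le (norm_nonneg _)
  have hfd : DifferentiableOn ℂ f (Metric.ball 0 r) := by
    refine (hd.add (DifferentiableOn.const_mul (DifferentiableOn.clog ?_ hslit) _)).sub_const _
    fun_prop
  have hball : Metric.eball (0 : ℂ) (ENNReal.ofReal r) = Metric.ball 0 r := Metric.eball_ofReal
  have hg₀a : AnalyticOnNhd ℂ g₀ (Metric.ball 0 r) := by
    rw [← hball]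
    exact hg₀.analyticOnNhd
  have hfa : AnalyticOnNhd ℂ f (Metric.ball 0 r) := hfd.analyticOnNhd Metric.isOpen_ball
  have hfg : ∀ᶠ t : ℂ in 𝓝[Metric.ball 0 r] (r : ℂ), f t = g₀ t := by
    filter_upwards [heq, self_mem_nhdsWithin] with t ht htb
    simp only [hf]
    rw [ht, log_one_div_one_sub_div (hslit t htb)]
    ring
  have hcl : (r : ℂ) ∈ closure (Metric.ball (0 : ℂ) r) := by
    rw [closure_ball _ hr.ne', mem_closedBall_zero_iff, Complex.norm_real, Real.norm_eq_abs,
      abs_of_pos hr]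
  obtain ⟨U, hU, hUo, hrU⟩ := eventually_nhds_iff.1 (eventually_nhdsWithin_iff.1 hfg)
  obtain ⟨t₀, ht₀U, ht₀⟩ := mem_closure_iff.1 hcl U hUo hrU
  -- The decomposition is assumed only near `r`, while the Taylor coefficients live at 0; analytic
  -- continuation through the connected disc links the two.
  have hEq : Set.EqOn f g₀ (Metric.ball 0 r) := by
    refine hfa.eqOn_of_preconnected_of_eventuallyEq hg₀a
      (convex_ball _ _).isPreconnected ht₀ ?_
    filter_upwards [(hUo.inter Metric.isOpen_ball).mem_nhds ⟨ht₀U, ht₀⟩] with t ht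
    exact hU t ht.1 ht.2
  have hfs := hasFPowerSeriesAt_add_log (θ := θ) hg hr 0
  have hg₀f : HasFPowerSeriesAt f (FormalMultilinearSeries.ofScalars ℂ b) 0 :=
    hg₀.hasFPowerSeriesAt.congr
      (Filter.eventuallyEq_of_mem (Metric.ball_mem_nhds 0 hr) hEq.symm)
  have hbeq := coeff_eq_of_hasFPowerSeriesAt hg₀f hfs
  have hbr : ∀ k : ℕ, b k * (r : ℂ) ^ k = ((Θ k * r ^ k / k - θ / k : ℝ) : ℂ) := by
    intro k
    have hrk : (r : ℂ) ^ k ≠ 0 := pow_ne_zero _ (by exact_mod_cast hr.ne')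
    rw [hbeq]
    simp only [ite_self, sub_zero]
    push_cast
    rcases eq_or_ne k 0 with rfl | hk
    · simp
    · have : (k : ℂ) ≠ 0 := by exact_mod_cast hk
      field_simp
  refine ⟨hr, by linarith, by linarith, exists_forall_le_of_isBigO (by linarith) ?_, ?_⟩
  · have h1 : (fun k : ℕ => Θ k * r ^ k / k - θ / k) =O[atTop]
        fun k : ℕ => b k * (r : ℂ) ^ k := by
      refine IsBigO.of_bound 1 (Eventually.of_forall fun k => ?_)
      rw [hbr, Complex.norm_real, one_mul]
    have h2 : (fun k : ℕ => (r : ℂ) ^ k) =O[atTop] fun k : ℕ => r ^ k :=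
      IsBigO.of_bound 1 (Eventually.of_forall fun k => by simp)
    refine (h1.trans (hb.mul h2)).congr_right fun k => ?_
    have hrk : (r : ℝ) ^ k ≠ 0 := pow_ne_zero _ hr.ne'
    rw [div_mul_cancel₀ _ hrk]
    congr 1
    ring
  · have : HasSum (fun k : ℕ => ((Θ k * r ^ k / k - θ / k : ℝ) : ℂ)) (K : ℂ) := by
      simpa only [hbr] using hsum
    exact Complex.hasSum_ofReal.1 this

/-! ### The class `F` -/

/-- Applying the cosine, decreasing on `[0, π]`, replaces the discontinuous argument by continuous
functions. The strict inequality excludes `z = r` by itself. -/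
theorem mem_deltaZero_iff {r R phi : ℝ} (h0 : 0 < phi) (h1 : phi < Real.pi / 2) {z : ℂ} :
    z ∈ deltaZero r R phi ↔ ‖z‖ < R ∧ (z - r).re < ‖z - r‖ * Real.cos phi := by
  have hpi := Real.pi_pos
  rw [deltaZero, Set.mem_ofPred_eq]
  refine and_congr_right fun _ => ?_
  rcases eq_or_ne z r with rfl | hz
  · simp
  have hz' : z - r ≠ 0 := sub_ne_zero.2 hz
  have hn : 0 < ‖z - r‖ := norm_pos_iff.2 hz'
  have hc := Complex.cos_arg hz'
  rw [← Real.cos_abs] at hc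
  have hiff := Real.strictAntiOn_cos.lt_iff_gt (a := |Complex.arg (z - r)|) (b := phi)
    ⟨abs_nonneg _, Complex.abs_arg_le_pi _⟩ ⟨h0.le, by linarith⟩
  rw [hc, div_lt_iff₀ hn] at hiff
  constructor
  · rintro ⟨-, h⟩
    rw [mul_comm]
    exact hiff.2 h
  · intro h
    rw [mul_comm] at h
    exact ⟨hz, hiff.1 h⟩

theorem isOpen_deltaZero {r R phi : ℝ} (h0 : 0 < phi) (h1 : phi < Real.pi / 2) :
    IsOpen (deltaZero r R phi) := by
  have : deltaZero r R phi = {z : ℂ | ‖z‖ < R} ∩ {z : ℂ | (z - r).re < ‖z - r‖ * Real.cos phi} := by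
    ext z
    exact mem_deltaZero_iff h0 h1
  rw [this]
  refine IsOpen.inter (isOpen_lt (by fun_prop) (by fun_prop)) (isOpen_lt ?_ (by fun_prop))
  exact Complex.continuous_re.comp (by fun_prop)

theorem mem_deltaZero_of_mem_closedBall {r R phi : ℝ} (hR : r < R) (h0 : 0 < phi)
    (h1 : phi < Real.pi / 2) {z : ℂ} (hz : ‖z‖ ≤ r) (hne : z ≠ r) : z ∈ deltaZero r R phi := by
  rw [mem_deltaZero_iff h0 h1]
  refine ⟨hz.trans_lt hR, (re_sub_neg_of_mem_closedBall hz hne).trans_le ?_⟩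
  have : 0 ≤ Real.cos phi := Real.cos_nonneg_of_neg_pi_div_two_le_of_le (by linarith) h1.le
  positivity

/-- Near `r`, Cauchy's estimate on a disc of radius proportional to `‖z - r‖` loses two powers of
that distance and `u` supplies one. Away from `r`, the rest of the closed disc is a compact subset
of `Δ₀`. -/
theorem exists_norm_iteratedDeriv_two_le {r R phi : ℝ} (hr : 0 < r) (hR : r < R) (h0 : 0 < phi)
    (h1 : phi < Real.pi / 2) {u : ℂ → ℂ} (hu : DifferentiableOn ℂ u (deltaZero r R phi))
    (hO : u =O[𝓝[deltaZero r R phi] (r : ℂ)] fun t : ℂ => t - (r : ℂ)) :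
    ∃ C : ℝ, 0 ≤ C ∧ ∀ z : ℂ, ‖z‖ < r → ‖iteratedDeriv 2 u z‖ ≤ C / ‖z - r‖ := by
  have hopen := isOpen_deltaZero (r := r) (R := R) h0 h1
  obtain ⟨M, hM0, hM⟩ := hO.exists_nonneg
  rw [IsBigOWith, eventually_nhdsWithin_iff, Metric.eventually_nhds_iff] at hM
  obtain ⟨η', hη', hM⟩ := hM
  set η := min η' (R - r) with hη
  have hη0 : 0 < η := lt_min hη' (by linarith)
  have hcos : 0 < Real.cos phi := Real.cos_pos_of_mem_Ioo ⟨by linarith, h1⟩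
  have hcos1 : Real.cos phi ≤ 1 := Real.cos_le_one phi
  -- Points `y` of the disc of radius `c‖z - r‖` satisfy `re (y - r) < c‖z - r‖`, while `‖y - r‖ cos
  -- phi ≥ (3/4)(4c)‖z - r‖`. Hence the disc avoids the excluded sector.
  set c := Real.cos phi / 4 with hc
  have hc0 : 0 < c := by positivity
  have hc1 : c ≤ 1 / 4 := by rw [hc]; linarith
  -- near `r`
  have hnear : ∀ z : ℂ, ‖z‖ < r → ‖z - r‖ < η / 2 →
      ‖iteratedDeriv 2 u z‖ ≤ (4 * M / c ^ 2) / ‖z - r‖ := by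
    intro z hz hzη
    have hzr : z ≠ r := ne_ofReal_of_mem_ball (mem_ball_zero_iff.2 hz)
    have hre := re_sub_neg_of_mem_closedBall hz.le hzr
    have hpos : 0 < ‖z - r‖ := norm_pos_iff.2 (sub_ne_zero.2 hzr)
    have hsub : ∀ y ∈ Metric.closedBall z (c * ‖z - r‖),
        y ∈ deltaZero r R phi ∧ ‖y - r‖ ≤ 2 * ‖z - r‖ := by
      intro y hy
      rw [mem_closedBall_iff_norm] at hy
      have e : y - r = (y - z) + (z - r) := by ring
      have hup : ‖y - r‖ ≤ 2 * ‖z - r‖ := by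
        rw [e]
        refine (norm_add_le _ _).trans ?_
        nlinarith
      have hlow : (1 - c) * ‖z - r‖ ≤ ‖y - r‖ := by
        have := norm_sub_norm_le (z - r) (-(y - z))
        rw [norm_neg, sub_neg_eq_add, add_comm (z - (r : ℂ)), ← e] at this
        linarith
      refine ⟨(mem_deltaZero_iff h0 h1).2 ⟨?_, ?_⟩, hup⟩
      · have h2 : ‖y‖ ≤ ‖y - r‖ + r := by
          have := norm_add_le (y - r) (r : ℂ)
          rwa [sub_add_cancel, Complex.norm_real, Real.norm_eq_abs, abs_of_pos hr] at this
        have := min_le_right η' (R - r)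
        linarith
      · have h2 : (y - r).re < c * ‖z - r‖ := by
          rw [e, Complex.add_re]
          have := (Complex.re_le_norm (y - z)).trans hy
          linarith
        have h3 : c * ‖z - r‖ ≤ ‖y - r‖ * Real.cos phi := by
          have : Real.cos phi = 4 * c := by rw [hc]; ring
          have h4 : 3 / 4 * ‖z - r‖ ≤ ‖y - r‖ := by nlinarith
          rw [this]
          nlinarith [mul_le_mul_of_nonneg_left h4 hc0.le, mul_pos hc0 hpos]
        linarith
    have hball : DiffContOnCl ℂ u (Metric.ball z (c * ‖z - r‖)) := by
      refine DifferentiableOn.diffContOnCl ?_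
      rw [closure_ball _ (by positivity)]
      exact hu.mono fun y hy => (hsub y hy).1
    have := Complex.norm_iteratedDeriv_le_of_forall_mem_sphere_norm_le (C := M * (2 * ‖z - r‖)) 2
      (by positivity : 0 < c * ‖z - r‖) hball (fun y hy => by
        obtain ⟨hy1, hy2⟩ := hsub y (Metric.sphere_subset_closedBall hy)
        refine (hM (y := y) ?_ hy1).trans (by gcongr)
        rw [dist_eq_norm]
        have := min_le_left η' (R - r)
        linarith)
    refine this.trans_eq ?_
    rw [Nat.factorial_two]
    push_cast
    field_simp
    ring
  -- away from `r`
  have hcompact : IsCompact (Metric.closedBall (0 : ℂ) r ∩ {z | η / 2 ≤ ‖z - r‖}) :=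
    (isCompact_closedBall _ _).inter_right (isClosed_le (by fun_prop) (by fun_prop))
  have hcont : ContinuousOn (iteratedDeriv 2 u) (deltaZero r R phi) := by
    have h2 : iteratedDeriv 2 u = deriv (deriv u) := by
      rw [iteratedDeriv_succ', iteratedDeriv_one]
    rw [h2]
    exact ((hu.deriv hopen).deriv hopen).continuousOn
  obtain ⟨M', hM'⟩ := hcompact.exists_bound_of_continuousOn (hcont.mono (by
    rintro z ⟨hz, hz2⟩
    refine mem_deltaZero_of_mem_closedBall hR h0 h1 (mem_closedBall_zero_iff.1 hz) ?_
    rintro rfl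
    simp at hz2
    linarith))
  refine ⟨4 * M / c ^ 2 + |M'| * (2 * r), by positivity, fun z hz => ?_⟩
  have hzr : z ≠ r := ne_ofReal_of_mem_ball (mem_ball_zero_iff.2 hz)
  have hpos : 0 < ‖z - r‖ := norm_pos_iff.2 (sub_ne_zero.2 hzr)
  rcases lt_or_ge ‖z - r‖ (η / 2) with h | h
  · refine (hnear z hz h).trans ?_
    gcongr
    exact le_add_of_nonneg_right (by positivity)
  · have h2 := hM' z ⟨mem_closedBall_zero_iff.2 hz.le, h⟩
    have h3 : ‖z - r‖ ≤ 2 * r := by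
      refine (norm_sub_le _ _).trans ?_
      rw [Complex.norm_real, Real.norm_eq_abs, abs_of_pos hr]
      linarith
    rw [le_div_iff₀ hpos]
    have h4 : 0 ≤ 4 * M / c ^ 2 := by positivity
    calc _ ≤ |M'| * (2 * r) := by
          gcongr
          exact h2.trans (le_abs_self _)
      _ ≤ _ := by linarith

/-- Moving the point radially out to the circle of radius `r` costs `r - ρ`, which is itself at most
the distance to `r`; so half of the chord length survives. -/
theorem mul_abs_le_norm_circleMap_sub {r ρ t : ℝ} (hρ : 0 ≤ ρ) (hρr : ρ ≤ r)
    (ht : |t| ≤ Real.pi) : r / Real.pi * |t| ≤ ‖circleMap 0 ρ t - r‖ := by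
  have hr : 0 ≤ r := hρ.trans hρr
  set e := Complex.exp ((t : ℂ) * Complex.I) with he
  have hen : ‖e‖ = 1 := Complex.norm_exp_ofReal_mul_I t
  have hcm : circleMap 0 ρ t = ρ * e := by simp [circleMap, he]
  have h1 := two_div_pi_mul_abs_le_norm_exp_sub_one ht
  rw [← he] at h1
  have h2 : ‖(r : ℂ) * e - ρ * e‖ = r - ρ := by
    rw [← sub_mul, norm_mul, hen, mul_one, ← Complex.ofReal_sub, Complex.norm_real,
      Real.norm_eq_abs, abs_of_nonneg (by linarith)]
  have h3 : r - ρ ≤ ‖(ρ : ℂ) * e - r‖ := by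
    have := norm_sub_norm_le (r : ℂ) (ρ * e)
    rw [norm_mul, hen, mul_one, Complex.norm_real, Complex.norm_real, Real.norm_of_nonneg hr,
      Real.norm_of_nonneg hρ, norm_sub_rev] at this
    exact this
  have h4 : r * ‖e - 1‖ ≤ ‖(r : ℂ) * e - ρ * e‖ + ‖(ρ : ℂ) * e - r‖ := by
    calc r * ‖e - 1‖ = ‖((r : ℂ) * e - ρ * e) + ((ρ : ℂ) * e - r)‖ := by
          have : ((r : ℂ) * e - ρ * e) + ((ρ : ℂ) * e - r) = r * (e - 1) := by ring
          rw [this, norm_mul, Complex.norm_real, Real.norm_of_nonneg hr]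
      _ ≤ _ := norm_add_le _ _
  rw [hcm]
  have h5 : r * (2 / Real.pi * |t|) ≤ r * ‖e - 1‖ := by gcongr
  have h6 : r * (2 / Real.pi * |t|) = 2 * (r / Real.pi * |t|) := by ring
  linarith

theorem sub_le_norm_circleMap_sub {r ρ t : ℝ} (hρ : 0 ≤ ρ) (hρr : ρ ≤ r) :
    r - ρ ≤ ‖circleMap 0 ρ t - r‖ := by
  have h := norm_sub_norm_le (r : ℂ) (circleMap 0 ρ t)
  rw [norm_circleMap_zero, abs_of_nonneg hρ, Complex.norm_real,
    Real.norm_of_nonneg (hρ.trans hρr), norm_sub_rev] at h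
  exact h

/-- Cauchy's estimate with the mean over the circle instead of the maximum. Below, the bound `C/‖z -
r‖` on the maximum would yield only non-summable coefficients of order `1/n`. -/
theorem norm_iteratedDeriv_le_integral_circleMap {f : ℂ → ℂ} {ρ : ℝ} (hρ : 0 < ρ)
    (hf : DifferentiableOn ℂ f (Metric.closedBall 0 ρ)) (n : ℕ) :
    ‖iteratedDeriv n f 0‖ ≤
      n ! * (((2 * Real.pi)⁻¹ * ∫ t in (-Real.pi)..Real.pi, ‖f (circleMap 0 ρ t)‖) * ρ⁻¹ ^ n) := by
  lift ρ to NNReal using hρ.le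
  have hρ' : 0 < ρ := hρ
  have h := hf.hasFPowerSeriesOnBall hρ'
  have h1 := h.factorial_smul 1 n
  rw [iteratedDeriv_eq_iteratedFDeriv, ← h1, nsmul_eq_mul, norm_mul, Complex.norm_natCast]
  have h2 := norm_cauchyPowerSeries_le f 0 ρ n
  have hper : Function.Periodic (fun t => ‖f (circleMap 0 ρ t)‖) (2 * Real.pi) := by
    intro t
    simp only
    rw [periodic_circleMap]
  have h3 := hper.intervalIntegral_add_eq 0 (-Real.pi)
  rw [zero_add, show -Real.pi + 2 * Real.pi = Real.pi by ring] at h3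
  rw [h3, abs_of_pos hρ] at h2
  gcongr
  refine le_trans ?_ h2
  have := (cauchyPowerSeries f 0 ρ n).le_opNorm (fun _ => (1 : ℂ))
  simpa only [norm_one, Finset.prod_const_one, mul_one] using this

/-- A function with an `O(t - r)` singularity in `Δ₀` has Taylor coefficients
`O(r ^ (-n) n ^ (-3 / 2))`. -/
theorem isBigO_coeff_of_isBigO_sub {r R phi : ℝ} (hr : 0 < r) (hR : r < R) (h0 : 0 < phi)
    (h1 : phi < Real.pi / 2) {u : ℂ → ℂ} (hu : DifferentiableOn ℂ u (deltaZero r R phi))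
    (hO : u =O[𝓝[deltaZero r R phi] (r : ℂ)] fun t : ℂ => t - (r : ℂ)) {c : ℕ → ℂ}
    (hc : HasFPowerSeriesAt u (FormalMultilinearSeries.ofScalars ℂ c) 0) :
    (fun n : ℕ => c n * (r : ℂ) ^ n) =O[atTop] fun n : ℕ => (n : ℝ) ^ (-(3 / 2 : ℝ)) := by
  obtain ⟨C, hC, hC'⟩ := exists_norm_iteratedDeriv_two_le hr hR h0 h1 hu hO
  have hpi := Real.pi_pos
  have hopen := isOpen_deltaZero (r := r) (R := R) h0 h1
  have hdd : DifferentiableOn ℂ (iteratedDeriv 2 u) (deltaZero r R phi) := by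
    have h2 : iteratedDeriv 2 u = deriv (deriv u) := by
      rw [iteratedDeriv_succ', iteratedDeriv_one]
    rw [h2]
    exact (hu.deriv hopen).deriv hopen
  have key : ∀ n : ℕ, ‖c (n + 2) * (r : ℂ) ^ (n + 2)‖ ≤
      (4 * C * r * Real.exp 1) * ((n + 2 : ℕ) : ℝ) ^ (-(3 / 2 : ℝ)) := by
    intro n
    set m : ℝ := (n : ℝ) + 2 with hm
    have hm0 : 0 < m := by positivity
    -- The circle lies at distance `r/m` from the singularity, and `(r/ρ)^n` stays below `e`.
    set ρ : ℝ := r * ((n + 1) / m) with hρ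
    have hρ0 : 0 < ρ := by positivity
    have hρr : ρ < r := by
      rw [hρ]
      refine mul_lt_of_lt_one_right hr ?_
      rw [div_lt_one hm0, hm]
      linarith
    have hsubρ : r - ρ = r / m := by
      rw [hρ, hm]; field_simp; ring
    have hdisc : DifferentiableOn ℂ (iteratedDeriv 2 u) (Metric.closedBall 0 ρ) := by
      refine hdd.mono fun z hz => ?_
      have hz' : ‖z‖ < r := (mem_closedBall_zero_iff.1 hz).trans_lt hρr
      exact mem_deltaZero_of_mem_closedBall hR h0 h1 hz'.le
        (ne_ofReal_of_mem_ball (mem_ball_zero_iff.2 hz'))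
    have h2 := norm_iteratedDeriv_le_integral_circleMap hρ0 hdisc n
    have h3 : iteratedDeriv n (iteratedDeriv 2 u) = iteratedDeriv (n + 2) u := by
      rw [iteratedDeriv_succ' (n := n + 1), iteratedDeriv_succ' (n := n), iteratedDeriv_succ',
        iteratedDeriv_one]
    rw [h3, iteratedDeriv_eq_factorial_mul hc, norm_mul, Complex.norm_natCast] at h2
    have hhalf : (-1 : ℝ) < -(1 / 2) := by norm_num
    have hint := integral_abs_rpow hpi.le hhalf
    have h4 : ∫ t in (-Real.pi)..Real.pi, ‖iteratedDeriv 2 u (circleMap 0 ρ t)‖ ≤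
        C * ((m / r) ^ (1 / 2 : ℝ) * (Real.pi / r) ^ (1 / 2 : ℝ)) *
          (2 * (Real.pi ^ (-(1 / 2 : ℝ) + 1) / (-(1 / 2) + 1))) := by
      rw [← hint.2, ← intervalIntegral.integral_const_mul]
      have hne : ∀ᵐ t : ℝ, t ≠ 0 := by
        simpa using (MeasureTheory.Measure.ae_ne volume (0 : ℝ))
      have hb := intervalIntegral.norm_integral_le_of_norm_le
        (f := fun t => ‖iteratedDeriv 2 u (circleMap 0 ρ t)‖)
        (g := fun t => C * ((m / r) ^ (1 / 2 : ℝ) * (Real.pi / r) ^ (1 / 2 : ℝ)) *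
          |t| ^ (-(1 / 2 : ℝ))) (by linarith : -Real.pi ≤ Real.pi)
        (hne.mono fun t ht0 ht => ?_) (hint.1.const_mul _)
      · exact (le_abs_self _).trans hb
      · have htp : 0 < |t| := abs_pos.2 ht0
        have hcirc : ‖circleMap 0 ρ t‖ < r := by
          rwa [norm_circleMap_zero, abs_of_pos hρ0]
        have hl1 := sub_le_norm_circleMap_sub (t := t) hρ0.le hρr.le
        have hl2 := mul_abs_le_norm_circleMap_sub hρ0.le hρr.le (mem_Ioc_pi_abs_le ht)
        rw [hsubρ] at hl1
        set D := ‖circleMap 0 ρ t - r‖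
        have hD : 0 < D := lt_of_lt_of_le (by positivity) hl1
        -- The geometric mean of the radial and angular bounds on `1/D` is integrable in `t` and of
        -- order `m^(1/2)`. With the factor `m (n + 1)` from two derivatives this gives the exponent
        -- `-3/2`.
        have hk := le_rpow_mul_rpow (x := m / r) (y := Real.pi / r * |t|⁻¹) (z := 1 / D)
          (p := 1 / 2) (by positivity)
          ((one_div_le_one_div_of_le (by positivity) hl1).trans_eq (by rw [one_div_div]))
          ((one_div_le_one_div_of_le (by positivity) hl2).trans_eq (by field_simp))
          (by norm_num) (by norm_num)
        rw [norm_norm]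
        refine (hC' _ hcirc).trans ?_
        rw [div_eq_mul_one_div]
        calc C * (1 / D) ≤ C * ((m / r) ^ (1 - 1 / 2 : ℝ) *
              (Real.pi / r * |t|⁻¹) ^ (1 / 2 : ℝ)) := by gcongr
          _ = _ := by
            rw [Real.mul_rpow (by positivity) (by positivity), Real.inv_rpow htp.le,
              ← Real.rpow_neg htp.le, show (1 - 1 / 2 : ℝ) = 1 / 2 by norm_num]
            ring
    have h5 : C * ((m / r) ^ (1 / 2 : ℝ) * (Real.pi / r) ^ (1 / 2 : ℝ)) *
          (2 * (Real.pi ^ (-(1 / 2 : ℝ) + 1) / (-(1 / 2) + 1))) =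
        4 * C * (Real.pi / r) * m ^ (1 / 2 : ℝ) := by
      have e1 : Real.pi ^ (1 / 2 : ℝ) * Real.pi ^ (1 / 2 : ℝ) = Real.pi := by
        rw [← Real.rpow_add hpi]; norm_num
      have e2 : r ^ (1 / 2 : ℝ) * r ^ (1 / 2 : ℝ) = r := by
        rw [← Real.rpow_add hr]; norm_num
      have e3 : (-(1 / 2 : ℝ) + 1) = 1 / 2 := by norm_num
      rw [e3, Real.div_rpow hm0.le hr.le, Real.div_rpow hpi.le hr.le]
      calc _ = 4 * C * (Real.pi ^ (1 / 2 : ℝ) * Real.pi ^ (1 / 2 : ℝ) /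
            (r ^ (1 / 2 : ℝ) * r ^ (1 / 2 : ℝ))) * m ^ (1 / 2 : ℝ) := by field_simp; ring
        _ = _ := by rw [e1, e2]
    rw [h5] at h4
    have h6 : ρ⁻¹ ^ n * r ^ n ≤ Real.exp 1 := by
      have e1 : ρ⁻¹ ^ n * r ^ n = (1 + 1 / ((n : ℝ) + 1)) ^ n := by
        rw [← mul_pow]
        congr 1
        rw [hρ, hm]
        field_simp
        ring
      rw [e1]
      have e2 : 1 + 1 / ((n : ℝ) + 1) ≤ Real.exp (1 / ((n : ℝ) + 1)) := by
        have := Real.add_one_le_exp (1 / ((n : ℝ) + 1))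
        linarith
      calc _ ≤ Real.exp (1 / ((n : ℝ) + 1)) ^ n := by gcongr
        _ = Real.exp (n * (1 / ((n : ℝ) + 1))) := by rw [← Real.exp_nat_mul]
        _ ≤ _ := by
          refine Real.exp_le_exp.2 ?_
          rw [mul_one_div, div_le_one (by positivity)]
          linarith
    have hfac : ((n + 2)! : ℝ) = (m * (n + 1)) * n ! := by
      rw [Nat.factorial_succ, Nat.factorial_succ, hm]
      push_cast
      ring
    rw [hfac, mul_assoc, mul_comm (n ! : ℝ) ‖c (n + 2)‖, ← mul_assoc] at h2
    have hnf : (0 : ℝ) < n ! := by exact_mod_cast n.factorial_pos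
    rw [mul_comm (n ! : ℝ)] at h2
    have h7 := le_of_mul_le_mul_right h2 hnf
    have h8 : m * (n + 1) * (‖c (n + 2)‖ * r ^ n) ≤
        2 * C / r * m ^ (1 / 2 : ℝ) * Real.exp 1 := by
      calc m * (n + 1) * (‖c (n + 2)‖ * r ^ n) = (m * (n + 1) * ‖c (n + 2)‖) * r ^ n := by ring
        _ ≤ (((2 * Real.pi)⁻¹ * (4 * C * (Real.pi / r) * m ^ (1 / 2 : ℝ))) * ρ⁻¹ ^ n) * r ^ n := by
            refine mul_le_mul_of_nonneg_right (h7.trans ?_) (by positivity)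
            gcongr
        _ = 2 * C / r * m ^ (1 / 2 : ℝ) * (ρ⁻¹ ^ n * r ^ n) := by
            field_simp
            ring
        _ ≤ _ := by gcongr
    have hm32 : m ^ (-(3 / 2 : ℝ)) * m ^ 2 = m ^ (1 / 2 : ℝ) := by
      rw [← Real.rpow_natCast, ← Real.rpow_add hm0]
      norm_num
    have hmn : m ≤ 2 * ((n : ℝ) + 1) := by
      rw [hm]
      have : (0 : ℝ) ≤ n := Nat.cast_nonneg n
      linarith
    have hnorm : ‖c (n + 2) * (r : ℂ) ^ (n + 2)‖ = ‖c (n + 2)‖ * r ^ n * r ^ 2 := by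
      rw [norm_mul, norm_pow, Complex.norm_real, Real.norm_of_nonneg hr.le, pow_add]
      ring
    have hcast : ((n + 2 : ℕ) : ℝ) = m := by rw [hm]; push_cast; ring
    rw [hnorm, hcast]
    have hX : 0 ≤ ‖c (n + 2)‖ * r ^ n := by positivity
    refine le_of_mul_le_mul_left ?_ (by positivity : 0 < m ^ 2)
    calc m ^ 2 * (‖c (n + 2)‖ * r ^ n * r ^ 2)
        ≤ (2 * (m * (n + 1) * (‖c (n + 2)‖ * r ^ n))) * r ^ 2 := by
          have : m ^ 2 * (‖c (n + 2)‖ * r ^ n) ≤ 2 * (m * (n + 1) * (‖c (n + 2)‖ * r ^ n)) := by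
            calc _ = m * m * (‖c (n + 2)‖ * r ^ n) := by ring
              _ ≤ m * (2 * ((n : ℝ) + 1)) * (‖c (n + 2)‖ * r ^ n) := by gcongr
              _ = _ := by ring
          calc _ = (m ^ 2 * (‖c (n + 2)‖ * r ^ n)) * r ^ 2 := by ring
            _ ≤ _ := by gcongr
      _ ≤ (2 * (2 * C / r * m ^ (1 / 2 : ℝ) * Real.exp 1)) * r ^ 2 := by gcongr
      _ = 4 * C * r * Real.exp 1 * (m ^ (-(3 / 2 : ℝ)) * m ^ 2) := by
          rw [hm32]
          field_simp
          ring
      _ = _ := by ring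
  refine IsBigO.of_bound (4 * C * r * Real.exp 1) ?_
  filter_upwards [eventually_ge_atTop 2] with n hn
  obtain ⟨k, rfl⟩ := Nat.exists_eq_add_of_le' hn
  rw [Real.norm_of_nonneg (by positivity : (0 : ℝ) ≤ ((k + 2 : ℕ) : ℝ) ^ (-(3 / 2 : ℝ)))]
  exact key k

theorem IsClassF.isLogPerturbation {Θ : ℕ → ℝ} {g : ℂ → ℂ}
    (hg : HasFPowerSeriesAt g (gSeries Θ) 0) {r θ K : ℝ} (h : IsClassF g r θ (K : ℂ)) :
    IsLogPerturbation Θ r θ K (3 / 2) := by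
  obtain ⟨hr, -, R, phi, hR, h0, h1, hd, hO⟩ := h
  set u : ℂ → ℂ := fun t => g t + θ * Complex.log (1 - t / r) - K with hu
  have hcos : 0 < Real.cos phi := Real.cos_pos_of_mem_Ioo ⟨by linarith, h1⟩
  have hslit : ∀ t ∈ deltaZero r R phi, 1 - t / r ∈ Complex.slitPlane := by
    intro t ht
    refine one_sub_div_mem_slitPlane hr ?_
    refine ((mem_deltaZero_iff h0 h1).1 ht).2.trans_le ?_
    exact mul_le_of_le_one_right (norm_nonneg _) (Real.cos_le_one phi)
  have hud : DifferentiableOn ℂ u (deltaZero r R phi) := by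
    refine (hd.add (DifferentiableOn.const_mul (DifferentiableOn.clog ?_ hslit) _)).sub_const _
    fun_prop
  have huO : u =O[𝓝[deltaZero r R phi] (r : ℂ)] fun t : ℂ => t - (r : ℂ) := by
    refine hO.congr' ?_ EventuallyEq.rfl
    filter_upwards [self_mem_nhdsWithin] with t ht
    rw [hu, log_one_div_one_sub_div (hslit t ht)]
    ring
  have hfs := hasFPowerSeriesAt_add_log (θ := θ) hg hr (K : ℂ)
  -- The constant `K` sits at index 0, where the other terms vanish by division by zero. As `u`
  -- tends to 0 at `r`, the rescaled coefficients sum to 0, and returning `K` at the end gives the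
  -- sum `K`.
  set c : ℕ → ℂ := fun k => ((Θ k / k - θ / (k * r ^ k) : ℝ) : ℂ) - if k = 0 then (K : ℂ) else 0
    with hc
  have hcO := isBigO_coeff_of_isBigO_sub hr hR h0 h1 hud huO hfs
  have hcr : ∀ k : ℕ, c k * (r : ℂ) ^ k =
      ((Θ k * r ^ k / k - θ / k - if k = 0 then K else 0 : ℝ) : ℂ) := by
    intro k
    have hrk : (r : ℂ) ^ k ≠ 0 := pow_ne_zero _ (by exact_mod_cast hr.ne')
    rcases eq_or_ne k 0 with rfl | hk
    · simp [hc]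
    · have : (k : ℂ) ≠ 0 := by exact_mod_cast hk
      simp only [hc, if_neg hk, sub_zero]
      push_cast
      field_simp
  have hsumm : Summable fun k : ℕ => c k * (r : ℂ) ^ k :=
    summable_of_isBigO_nat (Real.summable_nat_rpow.2 (by norm_num)) hcO
  -- Abel's theorem identifies the sum
  have hball : ∀ z : ℂ, ‖z‖ < r → z ∈ deltaZero r R phi := fun z hz =>
    mem_deltaZero_of_mem_closedBall hR h0 h1 hz.le (ne_ofReal_of_mem_ball (mem_ball_zero_iff.2 hz))
  have htaylor : ∀ x : ℝ, 0 < x → x < 1 →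
      ∑' k : ℕ, c k * (r : ℂ) ^ k * (x : ℂ) ^ k = u (x * r) := by
    intro x hx0 hx1
    have hmem : (x : ℂ) * r ∈ Metric.ball (0 : ℂ) r := by
      rw [mem_ball_zero_iff, norm_mul, Complex.norm_real, Complex.norm_real,
        Real.norm_of_nonneg hx0.le, Real.norm_of_nonneg hr.le]
      nlinarith
    have h2 := Complex.hasSum_taylorSeries_on_ball
      (hud.mono fun z hz => hball z (mem_ball_zero_iff.1 hz)) hmem
    rw [← h2.tsum_eq]
    refine tsum_congr fun k => ?_
    rw [iteratedDeriv_eq_factorial_mul hfs, sub_zero, smul_eq_mul, smul_eq_mul, mul_pow]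
    have : (k ! : ℂ) ≠ 0 := by exact_mod_cast k.factorial_ne_zero
    field_simp
  have habel := Complex.tendsto_tsum_powerSeries_nhdsWithin_lt hsumm.hasSum.tendsto_sum_nat
  rw [tendsto_map'_iff] at habel
  have hmap : Tendsto (fun x : ℝ => (x : ℂ) * r) (𝓝[<] 1) (𝓝[deltaZero r R phi] (r : ℂ)) := by
    refine tendsto_nhdsWithin_iff.2 ⟨?_, ?_⟩
    · have : Continuous fun x : ℝ => (x : ℂ) * r := by fun_prop
      simpa using (this.tendsto 1).mono_left nhdsWithin_le_nhds
    · filter_upwards [Ioo_mem_nhdsLT (zero_lt_one' ℝ)] with x hx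
      refine hball _ ?_
      rw [norm_mul, Complex.norm_real, Complex.norm_real,
        Real.norm_of_nonneg hx.1.le, Real.norm_of_nonneg hr.le]
      nlinarith [hx.2]
  have hu0 : Tendsto u (𝓝[deltaZero r R phi] (r : ℂ)) (𝓝 0) := by
    refine huO.trans_tendsto ?_
    have : Continuous fun t : ℂ => t - (r : ℂ) := by fun_prop
    simpa using (this.tendsto (r : ℂ)).mono_left nhdsWithin_le_nhds
  have hlim : Tendsto (fun x : ℝ => ∑' k : ℕ, c k * (r : ℂ) ^ k * (x : ℂ) ^ k) (𝓝[<] 1) (𝓝 0) := by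
    refine (hu0.comp hmap).congr' ?_
    filter_upwards [Ioo_mem_nhdsLT (zero_lt_one' ℝ)] with x hx
    exact (htaylor x hx.1 hx.2).symm
  have hzero := tendsto_nhds_unique habel hlim
  have hsum0 : HasSum (fun k : ℕ => Θ k * r ^ k / k - θ / k - if k = 0 then K else 0) 0 := by
    have h2 := hsumm.hasSum
    rw [hzero] at h2
    simp only [hcr] at h2
    exact Complex.hasSum_ofReal.1 (by simpa only [Complex.ofReal_zero] using h2)
  refine ⟨hr, by norm_num, by norm_num, exists_forall_le_of_isBigO (by norm_num) ?_, ?_⟩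
  · refine IsBigO.trans (IsBigO.of_bound 1 ?_) hcO
    filter_upwards [eventually_ge_atTop 1] with k hk
    rw [hcr, Complex.norm_real, if_neg (by omega), sub_zero, one_mul]
  · have := hsum0.add (hasSum_ite_eq 0 K)
    simpa using this

end

theorem mainTheorem6 (Θ : ℕ → ℝ) (hΘ : ∀ m : ℕ, 1 ≤ m → 0 ≤ Θ m)
    (g : ℂ → ℂ) (hg : HasFPowerSeriesAt g (gSeries Θ) 0)
    (r θ K : ℝ) (hθ : 0 < θ) :
    (IsClassF g r θ (K : ℂ) →
      (∀ᶠ n : ℕ in atTop, 0 < hNorm Θ n ∧ 0 < K + θ * Real.log n) ∧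
      (∃ c₁ : ℝ, 0 < c₁ ∧ ∀ n : ℕ, 2 ≤ n → 0 < hNorm Θ n → 0 ≤ K + θ * Real.log n →
        dLoc (lawTotalCycles Θ n) (poissonLaw (K + θ * Real.log n)) ≤ c₁ / Real.log n) ∧
      (∃ c₂ : ℝ, 0 < c₂ ∧ ∀ n : ℕ, 2 ≤ n → 0 < hNorm Θ n → 0 ≤ K + θ * Real.log n →
        dKol (lawTotalCycles Θ n) (poissonLaw (K + θ * Real.log n))
          ≤ c₂ / Real.sqrt (Real.log n))) ∧
    (∀ γ : ℝ, IsClassEF g r θ γ (K : ℂ) →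
      (∀ᶠ n : ℕ in atTop, 0 < hNorm Θ n ∧ 0 < K + θ * Real.log n) ∧
      (∃ c₃ : ℝ, 0 < c₃ ∧ ∀ n : ℕ, 2 ≤ n → 0 < hNorm Θ n → 0 ≤ K + θ * Real.log n →
        dLoc (lawTotalCycles Θ n) (poissonLaw (K + θ * Real.log n)) ≤ c₃ / Real.log n)) := by
  refine ⟨fun h => (h.isLogPerturbation hg).main hΘ hθ, fun γ h => ?_⟩
  obtain ⟨h1, h2, -⟩ := (h.isLogPerturbation hg).main hΘ hθ
  exact ⟨h1, h2⟩
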